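/- Let $\mathbb K$ be a field and let $E=(E^0,E^1,r,s)$ be an arbitrary directed graph. Let $L_{\mathbb K}(E)$ be its Leavitt path algebra, that is, the (not necessarily unital) associative $\mathbb K$-algebra generated by the vertices $v\in E^0$, the edges $e\in E^1$ and the ghost edges $e^*$ ($e\in E^1$), subject to the relations $vw=\delta_{v,w}v$ for $v,w\in E^0$; $s(e)e=e\,r(e)=e$ and $r(e)e^*=e^*s(e)=e^*$ for $e\in E^1$; $e^*f=\delta_{e,f}\,r(e)$ for $e,f\in E^1$; and $v=\sum_{s(e)=v}ee^*$ for every $v\in E^0$ for which $s^{-1}(v)$ is finite and nonempty. The centroid $\mathcal C(A)$ of a $\mathbb K$-algebra $A$ is the $\mathbb K$-algebra, under composition, of all $\mathbb K$-linear maps $\tau:A\to A$ with $\tau(xy)=\tau(x)y=x\tau(y)$ for all $x,y\in A$. The algebra $A$ is prime if $A\neq 0$ and, for two-sided ideals $I,J$ of $A$, $IJ=0$ implies $I=0$ or $J=0$. The graph $E$ is row-finite if $s^{-1}(v)$ is finite for every vertex $v$. A cycle is a path $c=e_1\cdots e_n$ with $n\ge 1$ (so $r(e_i)=s(e_{i+1})$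 for $i<n$), $r(e_n)=s(e_1)$, and $s(e_i)\ne s(e_j)$ for $i\neq j$; cycles that differ only by a cyclic rotation of their edges are identified. The graph $E$ is a comet if it has exactly one cycle $c$, from every vertex there is a path (possibly of length $0$) to a vertex of $c$, and every infinite path $f_0f_1f_2\cdots$ ends in $c$, i.e. has the form $\mu ccc\cdots$ with $\mu$ a finite (possibly trivial) path. **Theorem.** Suppose that $L_{\mathbb K}(E)$ is prime. If $E$ is a row-finite comet, then $\mathcal C(L_{\mathbb K}(E))\cong\mathbb K[x,x^{-1}]$ as $\mathbb K$-algebras. Otherwise, $\mathcal C(L_{\mathbb K}(E))\cong\mathbb K$ as $\mathbb K$-algebras. -/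

import Mathlib

universe u v w

/-! ### Directed graphs, paths, cycles, comets -/

/-- A directed graph `(E⁰, E¹, r, s)` with vertex type `V = E⁰` and edge type `E = E¹`, both
arbitrary. -/
structure DirectedGraph (V : Type u) (E : Type v) where
  /-- the source of an edge -/
  s : E → V
  /-- the range of an edge -/
  r : E → V

namespace DirectedGraph

variable {V : Type u} {E : Type v}

/-- The set `s⁻¹(v)` of edges emitted by the vertex `v`. -/
def emitted (G : DirectedGraph V E) (v : V) : Set E := {e | G.s e = v}

/-- A regular vertex: neither a sink nor an infinite emitter. -/
def IsRegular (G : DirectedGraph V E) (v : V) : Prop :=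
  (G.emitted v).Finite ∧ (G.emitted v).Nonempty

/-- A graph is row-finite if it has no infinite emitter. -/
def IsRowFinite (G : DirectedGraph V E) : Prop := ∀ v : V, (G.emitted v).Finite

/-- `G.IsPath u μ v`: the list of edges `μ = e₁ ⋯ eₙ` is a path from `u` to `v`.
The empty list is the path of length `0` at `u = v`. -/
def IsPath (G : DirectedGraph V E) : V → List E → V → Prop
  | u, [], v => u = v
  | u, e :: μ, v => G.s e = u ∧ IsPath G (G.r e) μ v

/-- The tree `T(u)` of a vertex: all vertices `v` such that there is a path from `u` to `v`. -/
def tree (G : DirectedGraph V E) (u : V) : Set V := {v | ∃ μ : List E, G.IsPath u μ v}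

/-- A cycle: a closed path of positive length whose edges have pairwise distinct sources. -/
def IsCycle (G : DirectedGraph V E) (c : List E) : Prop :=
  c ≠ [] ∧ (∃ v : V, G.IsPath v c v) ∧ (c.map G.s).Nodup

/-- The set `μ⁰` of vertices that are sources or ranges of the edges of `μ`. -/
def vertexSet (G : DirectedGraph V E) (μ : List E) : Set V :=
  {v | ∃ e ∈ μ, G.s e = v ∨ G.r e = v}

/-- An infinite path `f₀ f₁ f₂ ⋯`. -/
def IsInfinitePath (G : DirectedGraph V E) (f : ℕ → E) : Prop :=
  ∀ i : ℕ, G.r (f i) = G.s (f (i + 1))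

/-- The sequence of edges `f₀ f₁ f₂ ⋯` ends in `d`, i.e. it is of the form `μ d d d ⋯` for
some finite initial part `μ`. -/
def EndsIn (f : ℕ → E) (d : List E) : Prop :=
  ∃ N : ℕ, ∀ i : ℕ, d[i % d.length]? = some (f (N + i))

/-- A comet: a graph with exactly one cycle `c` (the cycles obtained from `c` by changing its
base point, that is by rotating the list of its edges, are identified with `c`), such that every
vertex connects to `c` and every infinite path ends in `c`. -/
def IsComet (G : DirectedGraph V E) : Prop :=
  ∃ c : List E, G.IsCycle c ∧ (∀ d : List E, G.IsCycle d → c.IsRotated d) ∧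
    (∀ v : V, (G.tree v ∩ G.vertexSet c).Nonempty) ∧
    (∀ f : ℕ → E, G.IsInfinitePath f → EndsIn f c)

end DirectedGraph

/-! ### Leavitt path algebras -/

namespace LeavittPath

variable {V : Type u} {E : Type v}

/-- The generators: vertices `v`, real edges `e` and ghost edges `e*`. -/
inductive Generator (V : Type u) (E : Type v) : Type (max u v)
  | vertex (v : V)
  | edge (e : E)
  | ghost (e : E)

/-- The free associative (non-unital) `K`-algebra on the generators. -/
abbrev FreeAlg (K : Type w) [Field K] (V : Type u) (E : Type v) : Type (max u v w) :=
  MonoidAlgebra K (FreeSemigroup (Generator V E))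

/-- A generator as an element of the free algebra. -/
noncomputable def gen (K : Type w) [Field K] (x : Generator V E) : FreeAlg K V E :=
  MonoidAlgebra.single (FreeSemigroup.of x) 1

/-- The defining relations of the Leavitt path algebra. -/
inductive Rel (K : Type w) [Field K] (G : DirectedGraph V E) :
    FreeAlg K V E → FreeAlg K V E → Prop
  /-- (V): `v v = v` -/
  | vertex_self (v : V) : Rel K G (gen K (.vertex v) * gen K (.vertex v)) (gen K (.vertex v))
  /-- (V): `v w = 0` for `v ≠ w` -/
  | vertex_ne (v w : V) (h : v ≠ w) : Rel K G (gen K (.vertex v) * gen K (.vertex w)) 0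
  /-- (E1): `s(e) e = e` -/
  | source_edge (e : E) : Rel K G (gen K (.vertex (G.s e)) * gen K (.edge e)) (gen K (.edge e))
  /-- (E1): `e r(e) = e` -/
  | edge_range (e : E) : Rel K G (gen K (.edge e) * gen K (.vertex (G.r e))) (gen K (.edge e))
  /-- (E2): `r(e) e* = e*` -/
  | range_ghost (e : E) : Rel K G (gen K (.vertex (G.r e)) * gen K (.ghost e)) (gen K (.ghost e))
  /-- (E2): `e* s(e) = e*` -/
  | ghost_source (e : E) : Rel K G (gen K (.ghost e) * gen K (.vertex (G.s e))) (gen K (.ghost e))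
  /-- (CK1): `e* e = r(e)` -/
  | ck1_self (e : E) : Rel K G (gen K (.ghost e) * gen K (.edge e)) (gen K (.vertex (G.r e)))
  /-- (CK1): `e* f = 0` for `e ≠ f` -/
  | ck1_ne (e f : E) (h : e ≠ f) : Rel K G (gen K (.ghost e) * gen K (.edge f)) 0
  /-- (CK2): `v = ∑_{s(e) = v} e e*` for every regular vertex `v` -/
  | ck2 (v : V) (h : G.IsRegular v) :
      Rel K G (gen K (.vertex v)) (∑ e ∈ h.1.toFinset, gen K (.edge e) * gen K (.ghost e))

/-- The smallest `K`-algebra congruence containing the defining relations, i.e. congruence modulo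
the algebra ideal that they generate. (As the free algebra has no unit, the multiples of the
relations by scalars have to be listed among the generators of the ring congruence.) -/
noncomputable def con (K : Type w) [Field K] (G : DirectedGraph V E) : RingCon (FreeAlg K V E) :=
  ringConGen fun x y => ∃ (k : K) (a b : FreeAlg K V E), Rel K G a b ∧ x = k • a ∧ y = k • b

theorem con_smul (K : Type w) [Field K] (G : DirectedGraph V E) (k : K)
    {x y : FreeAlg K V E} (h : con K G x y) : con K G (k • x) (k • y) := by
  have h' : RingConGen.Rel _ x y := h
  induction h' with
  | of x y hxy =>
    obtain ⟨l, a, b, hab, rfl, rfl⟩ := hxy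
    exact RingConGen.Rel.of _ _ ⟨k * l, a, b, hab, smul_smul _ _ _, smul_smul _ _ _⟩
  | refl x => exact (con K G).refl _
  | symm hxy ih => exact (con K G).symm (ih hxy)
  | trans hxy hyz ih1 ih2 => exact (con K G).trans (ih1 hxy) (ih2 hyz)
  | add hwx hyz ih1 ih2 =>
    rw [smul_add, smul_add]
    exact (con K G).add (ih1 hwx) (ih2 hyz)
  | mul hwx hyz ih1 ih2 =>
    rw [← smul_mul_assoc, ← smul_mul_assoc]
    exact (con K G).mul (ih1 hwx) hyz

end LeavittPath

/-- The Leavitt path algebra `L_K(G)`: the (in general non-unital) associative `K`-algebra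
generated by the vertices, edges and ghost edges of `G` subject to the relations (V), (E1), (E2),
(CK1), (CK2). -/
def LeavittPathAlgebra (K : Type w) [Field K] {V : Type u} {E : Type v}
    (G : DirectedGraph V E) : Type (max u v w) :=
  (LeavittPath.con K G).Quotient

namespace LeavittPathAlgebra

variable {V : Type u} {E : Type v}

noncomputable instance instNonUnitalRing (K : Type w) [Field K] (G : DirectedGraph V E) :
    NonUnitalRing (LeavittPathAlgebra K G) :=
  inferInstanceAs (NonUnitalRing (LeavittPath.con K G).Quotient)

/-- The quotient map from the free algebra. -/
noncomputable def mk (K : Type w) [Field K] (G : DirectedGraph V E) (x : LeavittPath.FreeAlg K V E) :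
    LeavittPathAlgebra K G :=
  (x : (LeavittPath.con K G).Quotient)

/-- Scalar multiplication, induced from the free algebra. -/
noncomputable instance instSMul (K : Type w) [Field K] (G : DirectedGraph V E) :
    SMul K (LeavittPathAlgebra K G) where
  smul k := Quotient.map' (fun x => k • x) fun _ _ h => LeavittPath.con_smul K G k h

noncomputable instance instModule (K : Type w) [Field K] (G : DirectedGraph V E) :
    Module K (LeavittPathAlgebra K G) :=
  Function.Surjective.module K
    (⟨⟨mk K G, rfl⟩, fun _ _ => rfl⟩ : LeavittPath.FreeAlg K V E →+ LeavittPathAlgebra K G)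
    Quotient.mk''_surjective (fun _ _ => rfl)

instance instIsScalarTower (K : Type w) [Field K] (G : DirectedGraph V E) :
    IsScalarTower K (LeavittPathAlgebra K G) (LeavittPathAlgebra K G) where
  smul_assoc k x y := by
    obtain ⟨x, rfl⟩ := Quotient.mk''_surjective x
    obtain ⟨y, rfl⟩ := Quotient.mk''_surjective y
    exact congrArg (mk K G) (smul_mul_assoc k x y)

instance instSMulCommClass (K : Type w) [Field K] (G : DirectedGraph V E) :
    SMulCommClass K (LeavittPathAlgebra K G) (LeavittPathAlgebra K G) where
  smul_comm k x y := by
    obtain ⟨x, rfl⟩ := Quotient.mk''_surjective x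
    obtain ⟨y, rfl⟩ := Quotient.mk''_surjective y
    exact congrArg (mk K G) (mul_smul_comm k x y).symm

end LeavittPathAlgebra

/-! ### Centroids and prime algebras -/

/-- The centroid of a `K`-algebra `A`: the linear maps `τ : A → A` such that
`τ(xy) = τ(x)y = xτ(y)`, a `K`-algebra under composition. -/
def algebraCentroid (K : Type w) [Field K] (A : Type u) [NonUnitalRing A] [Module K A]
    [IsScalarTower K A A] [SMulCommClass K A A] : Subalgebra K (Module.End K A) where
  carrier := {τ | ∀ x y : A, τ (x * y) = τ x * y ∧ τ (x * y) = x * τ y}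
  mul_mem' {σ τ} hσ hτ x y :=
    ⟨by rw [Module.End.mul_apply, (hτ x y).1, (hσ (τ x) y).1, Module.End.mul_apply],
     by rw [Module.End.mul_apply, (hτ x y).2, (hσ x (τ y)).2, Module.End.mul_apply]⟩
  add_mem' {σ τ} hσ hτ x y :=
    ⟨by rw [LinearMap.add_apply, LinearMap.add_apply, (hσ x y).1, (hτ x y).1, add_mul],
     by rw [LinearMap.add_apply, LinearMap.add_apply, (hσ x y).2, (hτ x y).2, mul_add]⟩
  algebraMap_mem' k x y :=
    ⟨by simp only [Module.algebraMap_end_apply, smul_mul_assoc],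
     by simp only [Module.algebraMap_end_apply, mul_smul_comm]⟩

/-- A prime (not necessarily unital) ring: it is nonzero, and `I J = 0` for two-sided ideals
`I`, `J` only if `I = 0` or `J = 0`. -/
def IsPrimeAlgebra (A : Type u) [NonUnitalRing A] : Prop :=
  Nontrivial A ∧ ∀ I J : TwoSidedIdeal A,
    (∀ x ∈ I, ∀ y ∈ J, x * y = 0) → I = ⊥ ∨ J = ⊥

/-! ### Concatenation and splitting of paths -/

namespace DirectedGraph

variable {V : Type u} {E : Type v} {G : DirectedGraph V E}

/-! Primeness gives: if `a s b = 0` for all `s`, then `a = 0` or `b = 0`. As `τ(a) s v = a s τ(v)`,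
a centroid element is determined by its value at any one vertex, and it is a scalar as soon as it
maps a single vertex `w` to `k w`.

For a path `μ` from `v` to `w`, `μ* τ(v) μ = τ(w)`. If `τ` is not a scalar, no such compression may
end in a multiple of `w`. But `μ* a μ` is a multiple of `w`, for a given `a`, when `μ` is a
sufficiently aperiodic path (`exists_compress_of_isAperiodic`), an edge outside some finite set
(`exists_compress_edge`), or the trivial path at a sink (`exists_compress_sink`). Hence there are no
sinks and no infinite emitters, cycles have no exits, and infinite paths must repeat a vertex and so
end in a cycle. By primeness two exitless cycles agree up to rotation, so the graph is a row-finite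
comet (`isComet_of_centroid`).

Conversely, let `c` be the cycle of a row-finite comet, based at `u`. It has no exit, so `c c* = u =
c* c`, and the corner at `u` is spanned by products of powers of `c` and `c*`; both are central
there. A central element `z` of the corner extends to the centroid (`exists_mem_centroid`): an
obstruction at a vertex would propagate along an infinite path, which has to reach `u`, where there
is none. Thus `c` and `c*` give mutually inverse centroid elements. Evaluation at `u` shows that
their powers span the centroid, and that the powers of `c` are independent because a representation
with a degree separates paths of different lengths (`linearIndependent_path`). -/

theorem IsPath.append {u v w : V} {μ ν : List E} (hμ : G.IsPath u μ v) (hν : G.IsPath v ν w) :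
    G.IsPath u (μ ++ ν) w := by
  induction μ generalizing u with
  | nil => obtain rfl : u = v := hμ; exact hν
  | cons e μ ih => exact ⟨hμ.1, ih hμ.2⟩

theorem IsPath.split {u w : V} {μ ν : List E} (h : G.IsPath u (μ ++ ν) w) :
    ∃ v, G.IsPath u μ v ∧ G.IsPath v ν w := by
  induction μ generalizing u with
  | nil => exact ⟨u, rfl, h⟩
  | cons e μ ih => obtain ⟨v, h1, h2⟩ := ih h.2; exact ⟨v, ⟨h.1, h1⟩, h2⟩

theorem IsPath.range_unique {u v w : V} {μ : List E} (h : G.IsPath u μ v) (h' : G.IsPath u μ w) :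
    v = w := by
  induction μ generalizing u with
  | nil => exact Eq.trans (Eq.symm h) h'
  | cons e μ ih => exact ih h.2 h'.2

end DirectedGraph

/-! ### Paths and ghost paths as elements of the algebra -/

namespace LeavittPathAlgebra

variable {V : Type u} {E : Type v} (K : Type w) [Field K] (G : DirectedGraph V E)

/-- The vertex `v` as an element of the Leavitt path algebra. -/
noncomputable def vertex (v : V) : LeavittPathAlgebra K G := mk K G (LeavittPath.gen K (.vertex v))

/-- The edge `e` as an element of the Leavitt path algebra. -/
noncomputable def edge (e : E) : LeavittPathAlgebra K G := mk K G (LeavittPath.gen K (.edge e))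

/-- The ghost edge `e*` as an element of the Leavitt path algebra. -/
noncomputable def ghost (e : E) : LeavittPathAlgebra K G := mk K G (LeavittPath.gen K (.ghost e))

theorem mk_eq_of_rel {a b : LeavittPath.FreeAlg K V E} (h : LeavittPath.Rel K G a b) :
    mk K G a = mk K G b :=
  Quotient.sound (RingConGen.Rel.of _ _ ⟨1, a, b, h, (one_smul K a).symm, (one_smul K b).symm⟩)

/-- The quotient map from the free algebra as a homomorphism. -/
noncomputable def mkHom : LeavittPath.FreeAlg K V E →ₙₐ[K] LeavittPathAlgebra K G where
  toFun := mk K G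
  map_smul' _ _ := rfl
  map_zero' := rfl
  map_add' _ _ := rfl
  map_mul' _ _ := rfl

theorem vertex_mul_self (v : V) : vertex K G v * vertex K G v = vertex K G v :=
  mk_eq_of_rel K G (.vertex_self v)

theorem vertex_mul_of_ne {v w : V} (h : v ≠ w) : vertex K G v * vertex K G w = 0 :=
  mk_eq_of_rel K G (.vertex_ne v w h)

theorem source_mul_edge (e : E) : vertex K G (G.s e) * edge K G e = edge K G e :=
  mk_eq_of_rel K G (.source_edge e)

theorem edge_mul_range (e : E) : edge K G e * vertex K G (G.r e) = edge K G e :=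
  mk_eq_of_rel K G (.edge_range e)

theorem range_mul_ghost (e : E) : vertex K G (G.r e) * ghost K G e = ghost K G e :=
  mk_eq_of_rel K G (.range_ghost e)

theorem ghost_mul_source (e : E) : ghost K G e * vertex K G (G.s e) = ghost K G e :=
  mk_eq_of_rel K G (.ghost_source e)

theorem ghost_mul_edge (e : E) : ghost K G e * edge K G e = vertex K G (G.r e) :=
  mk_eq_of_rel K G (.ck1_self e)

theorem ghost_mul_edge_of_ne {e f : E} (h : e ≠ f) : ghost K G e * edge K G f = 0 :=
  mk_eq_of_rel K G (.ck1_ne e f h)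

theorem vertex_eq_sum (v : V) (h : G.IsRegular v) :
    vertex K G v = ∑ e ∈ h.1.toFinset, edge K G e * ghost K G e := by
  refine (mk_eq_of_rel K G (.ck2 v h)).trans ?_
  exact map_sum (mkHom K G) _ _

/-- The element of the Leavitt path algebra given by a path starting at `u`. -/
noncomputable def path : V → List E → LeavittPathAlgebra K G
  | u, [] => vertex K G u
  | _, e :: μ => edge K G e * path (G.r e) μ

/-- The element `μ*` of the Leavitt path algebra given by a path `μ` starting at `u`. -/
noncomputable def ghostPath : V → List E → LeavittPathAlgebra K G
  | u, [] => vertex K G u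
  | _, e :: μ => ghostPath (G.r e) μ * ghost K G e

variable {G}

theorem source_mul_path {u v : V} {μ : List E} (h : G.IsPath u μ v) :
    vertex K G u * path K G u μ = path K G u μ := by
  cases μ with
  | nil => exact vertex_mul_self K G u
  | cons e μ => rw [path, ← mul_assoc, ← h.1, source_mul_edge]

theorem ghostPath_mul_source {u v : V} {μ : List E} (h : G.IsPath u μ v) :
    ghostPath K G u μ * vertex K G u = ghostPath K G u μ := by
  cases μ with
  | nil => exact vertex_mul_self K G u
  | cons e μ => rw [ghostPath, mul_assoc, ← h.1, ghost_mul_source]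

theorem vertex_mul_path_of_ne {u v w : V} {μ : List E} (h : G.IsPath u μ v) (hw : w ≠ u) :
    vertex K G w * path K G u μ = 0 := by
  rw [← source_mul_path K h, ← mul_assoc, vertex_mul_of_ne K G hw, zero_mul]

theorem ghostPath_mul_vertex_of_ne {u v w : V} {μ : List E} (h : G.IsPath u μ v) (hw : w ≠ u) :
    ghostPath K G u μ * vertex K G w = 0 := by
  rw [← ghostPath_mul_source K h, mul_assoc, vertex_mul_of_ne K G hw.symm, mul_zero]

theorem path_append {u v : V} {μ : List E} (ν : List E) (h : G.IsPath u μ v)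
    {w : V} (hν : G.IsPath v ν w) :
    path K G u (μ ++ ν) = path K G u μ * path K G v ν := by
  induction μ generalizing u with
  | nil => obtain rfl : u = v := h; exact (source_mul_path K hν).symm
  | cons e μ ih => rw [List.cons_append, path, path, ih h.2, mul_assoc]

theorem ghostPath_append {u v : V} {μ : List E} (ν : List E) (h : G.IsPath u μ v)
    {w : V} (hν : G.IsPath v ν w) :
    ghostPath K G u (μ ++ ν) = ghostPath K G v ν * ghostPath K G u μ := by
  induction μ generalizing u with
  | nil => obtain rfl : u = v := h; exact (ghostPath_mul_source K hν).symm
  | cons e μ ih => rw [List.cons_append, ghostPath, ghostPath, ih h.2, mul_assoc]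

theorem path_mul_range {u v : V} {μ : List E} (h : G.IsPath u μ v) :
    path K G u μ * vertex K G v = path K G u μ := by
  rw [← path, ← path_append K (w := v) [] h rfl, List.append_nil]

theorem range_mul_ghostPath {u v : V} {μ : List E} (h : G.IsPath u μ v) :
    vertex K G v * ghostPath K G u μ = ghostPath K G u μ := by
  rw [← ghostPath, ← ghostPath_append K (w := v) [] h rfl, List.append_nil]

theorem ghostPath_mul_path {u v : V} {μ : List E} (h : G.IsPath u μ v) :
    ghostPath K G u μ * path K G u μ = vertex K G v := by
  induction μ generalizing u with
  | nil => obtain rfl : u = v := h; exact vertex_mul_self K G u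
  | cons e μ ih =>
    rw [ghostPath, path, mul_assoc, ← mul_assoc (ghost K G e), ghost_mul_edge,
      source_mul_path K h.2, ih h.2]

theorem ghostPath_mul_path_append {u v w : V} {μ ν : List E} (h : G.IsPath u μ v)
    (hν : G.IsPath v ν w) : ghostPath K G u μ * path K G u (μ ++ ν) = path K G v ν := by
  rw [path_append K ν h hν, ← mul_assoc, ghostPath_mul_path K h, source_mul_path K hν]

theorem ghostPath_append_mul_path {u v w : V} {μ ν : List E} (h : G.IsPath u μ v)
    (hν : G.IsPath v ν w) : ghostPath K G u (μ ++ ν) * path K G u μ = ghostPath K G v ν := by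
  rw [ghostPath_append K ν h hν, mul_assoc, ghostPath_mul_path K h, ghostPath_mul_source K hν]

/-- `μ* ν = 0` for incomparable paths `μ`, `ν`. -/
theorem ghostPath_mul_path_eq_zero {u v w : V} {μ ν : List E} (hμ : G.IsPath u μ v)
    (hν : G.IsPath u ν w) (h₁ : ¬ μ <+: ν) (h₂ : ¬ ν <+: μ) :
    ghostPath K G u μ * path K G u ν = 0 := by
  induction μ generalizing u ν with
  | nil => exact absurd List.nil_prefix h₁
  | cons e μ ih =>
    cases ν with
    | nil => exact absurd List.nil_prefix h₂
    | cons f ν =>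
      rw [ghostPath, path, mul_assoc, ← mul_assoc (ghost K G e)]
      by_cases hef : e = f
      · subst hef
        rw [ghost_mul_edge, source_mul_path K hν.2]
        refine ih hμ.2 hν.2 (fun h => h₁ ?_) (fun h => h₂ ?_) <;> simpa using h
      · rw [ghost_mul_edge_of_ne K G hef, zero_mul, mul_zero]

/-! ### The spanning set of the elements `α β*` -/

theorem edge_mul_path_of_ne {u v : V} {μ : List E} {e : E} (h : G.IsPath u μ v) (he : G.r e ≠ u) :
    edge K G e * path K G u μ = 0 := by
  rw [← edge_mul_range, mul_assoc, vertex_mul_path_of_ne K h he, mul_zero]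

theorem ghost_mul_path_of_ne {u v : V} {μ : List E} {e : E} (h : G.IsPath u μ v)
    (he : G.s e ≠ u) : ghost K G e * path K G u μ = 0 := by
  rw [← ghost_mul_source, mul_assoc, vertex_mul_path_of_ne K h he, mul_zero]

variable (G)

/-- The elements `α β*` with paths `α`, `β` of the same range. -/
def monomials : Set (LeavittPathAlgebra K G) :=
  {x | ∃ u v w α β, G.IsPath u α w ∧ G.IsPath v β w ∧ x = path K G u α * ghostPath K G v β}

/-- A generator on the left kills a monomial, lengthens or shortens `α`, or, if it is a ghost edge
and `α` is trivial, is absorbed into `β*`. Left multiplication suffices because every word is built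
up from its right end. -/
theorem mk_gen_mul_mem_span (g : LeavittPath.Generator V E) {x : LeavittPathAlgebra K G}
    (hx : x ∈ monomials K G) :
    mk K G (LeavittPath.gen K g) * x ∈ Submodule.span K (monomials K G) := by
  classical
  obtain ⟨u, v, w, α, β, hα, hβ, rfl⟩ := hx
  rw [← mul_assoc]
  cases g with
  | vertex t =>
    change vertex K G t * _ * _ ∈ _
    by_cases h : t = u
    · subst h
      rw [source_mul_path K hα]
      exact Submodule.subset_span ⟨_, _, _, _, _, hα, hβ, rfl⟩
    · rw [vertex_mul_path_of_ne K hα h, zero_mul]; exact zero_mem _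
  | edge e =>
    change edge K G e * _ * _ ∈ _
    by_cases h : G.r e = u
    · subst h
      exact Submodule.subset_span ⟨G.s e, _, _, e :: α, _, ⟨rfl, hα⟩, hβ, rfl⟩
    · rw [edge_mul_path_of_ne K hα h, zero_mul]; exact zero_mem _
  | ghost e =>
    change ghost K G e * _ * _ ∈ _
    by_cases h : G.s e = u
    · subst h
      cases α with
      | nil =>
        obtain rfl : G.s e = w := hα
        have he : G.IsPath (G.s e) [e] (G.r e) := ⟨rfl, rfl⟩
        refine Submodule.subset_span
          ⟨G.r e, v, G.r e, [], β ++ [e], rfl, hβ.append he, ?_⟩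
        rw [ghostPath_append K _ hβ he, path, path, ghost_mul_source, ghostPath, ghostPath,
          ← mul_assoc, range_mul_ghost, range_mul_ghost]
      | cons f α =>
        rw [path, ← mul_assoc]
        by_cases hef : e = f
        · subst hef
          rw [ghost_mul_edge, source_mul_path K hα.2]
          exact Submodule.subset_span ⟨_, _, _, _, _, hα.2, hβ, rfl⟩
        · rw [ghost_mul_edge_of_ne K G hef, zero_mul, zero_mul]; exact zero_mem _
    · rw [ghost_mul_path_of_ne K hα h, zero_mul]; exact zero_mem _

theorem mk_gen_mem_span (g : LeavittPath.Generator V E) :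
    mk K G (LeavittPath.gen K g) ∈ Submodule.span K (monomials K G) := by
  cases g with
  | vertex t =>
    exact Submodule.subset_span ⟨t, t, t, [], [], rfl, rfl, (vertex_mul_self K G t).symm⟩
  | edge e =>
    refine Submodule.subset_span ⟨G.s e, G.r e, G.r e, [e], [], ⟨rfl, rfl⟩, rfl, ?_⟩
    rw [path, path, ghostPath, edge_mul_range, edge_mul_range]; rfl
  | ghost e =>
    refine Submodule.subset_span ⟨G.r e, G.s e, G.r e, [], [e], rfl, ⟨rfl, rfl⟩, ?_⟩
    rw [path, ghostPath, ghostPath, range_mul_ghost, range_mul_ghost]; rfl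

/-- The Leavitt path algebra is spanned by the elements `α β*`. -/
theorem span_monomials : Submodule.span K (monomials K G) = ⊤ := by
  have hmul : ∀ g, ∀ x ∈ Submodule.span K (monomials K G),
      mk K G (LeavittPath.gen K g) * x ∈ Submodule.span K (monomials K G) := by
    intro g x hx
    induction hx using Submodule.span_induction with
    | mem x hx => exact mk_gen_mul_mem_span K G g hx
    | zero => rw [mul_zero]; exact zero_mem _
    | add x y _ _ hx hy => rw [mul_add]; exact add_mem hx hy
    | smul k x _ hx => rw [mul_smul_comm]; exact Submodule.smul_mem _ _ hx
  have hsg : ∀ x : FreeSemigroup (LeavittPath.Generator V E),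
      mk K G (MonoidAlgebra.single x 1) ∈ Submodule.span K (monomials K G) := by
    intro x
    induction x using FreeSemigroup.recOnMul with
    | ih1 g => exact mk_gen_mem_span K G g
    | ih2 g y _ hy =>
      have := hmul g _ hy
      change mk K G (LeavittPath.gen K g * MonoidAlgebra.single y 1) ∈ _ at this
      rwa [LeavittPath.gen, MonoidAlgebra.single_mul_single, one_mul] at this
  refine eq_top_iff.2 fun a ha => ?_
  clear ha
  obtain ⟨a, rfl⟩ := Quotient.mk''_surjective a
  change mkHom K G a ∈ _
  induction a using MonoidAlgebra.induction_linear with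
  | zero => rw [map_zero]; exact zero_mem _
  | add f g hf hg => rw [map_add]; exact add_mem hf hg
  | single x k =>
    rw [show MonoidAlgebra.single x k = k • MonoidAlgebra.single x (1 : K) by simp, map_smul]
    exact Submodule.smul_mem _ _ (hsg x)

variable {G}

/-- To prove a statement for all elements of the Leavitt path algebra, one may assume that the
element is of the form `α β*`. -/
theorem induction_on {p : LeavittPathAlgebra K G → Prop} (a : LeavittPathAlgebra K G)
    (zero : p 0) (add : ∀ a b, p a → p b → p (a + b)) (smul : ∀ (k : K) a, p a → p (k • a))
    (monomial : ∀ u v w α β, G.IsPath u α w → G.IsPath v β w →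
      p (path K G u α * ghostPath K G v β)) : p a := by
  have ha : a ∈ Submodule.span K (monomials K G) := span_monomials K G ▸ Submodule.mem_top
  induction ha using Submodule.span_induction with
  | mem x hx => obtain ⟨u, v, w, α, β, hα, hβ, rfl⟩ := hx; exact monomial _ _ _ _ _ hα hβ
  | zero => exact zero
  | add x y _ _ hx hy => exact add _ _ hx hy
  | smul k x _ hx => exact smul _ _ hx

end LeavittPathAlgebra

/-! ### The universal property -/

namespace LeavittPathAlgebra

section UniversalProperty

variable {V : Type u} {E : Type v} {K : Type w} [Field K] {G : DirectedGraph V E}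
  {A : Type*} [NonUnitalRing A] [Module K A] [IsScalarTower K A A] [SMulCommClass K A A]

/-- The homomorphism from the free algebra determined by the values on the generators. -/
noncomputable def freeLift (f : LeavittPath.Generator V E → A) :
    LeavittPath.FreeAlg K V E →ₙₐ[K] A :=
  MonoidAlgebra.liftMagma K (FreeSemigroup.lift f)

theorem freeLift_gen (f : LeavittPath.Generator V E → A) (x : LeavittPath.Generator V E) :
    freeLift f (LeavittPath.gen K x) = f x := by
  simp [freeLift, LeavittPath.gen]

/-- The universal property of the Leavitt path algebra. -/
noncomputable def lift (f : LeavittPath.Generator V E → A)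
    (hf : ∀ a b, LeavittPath.Rel K G a b → freeLift f a = freeLift f b) :
    LeavittPathAlgebra K G →ₙₐ[K] A where
  toFun := Quotient.lift (freeLift f) <| by
    intro a b h
    have h' : RingConGen.Rel _ a b := h
    induction h' with
    | of x y hxy =>
      obtain ⟨k, a, b, hab, rfl, rfl⟩ := hxy
      rw [map_smul, map_smul, hf a b hab]
    | refl x => rfl
    | symm hxy ih => exact (ih hxy).symm
    | trans hxy hyz ih1 ih2 => exact (ih1 hxy).trans (ih2 hyz)
    | add hwx hyz ih1 ih2 => rw [map_add, map_add, ih1 hwx, ih2 hyz]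
    | mul hwx hyz ih1 ih2 => rw [map_mul, map_mul, ih1 hwx, ih2 hyz]
  map_smul' k x := by
    obtain ⟨x, rfl⟩ := Quotient.mk''_surjective x
    exact map_smul (freeLift f) k x
  map_zero' := map_zero (freeLift f)
  map_add' x y := by
    obtain ⟨x, rfl⟩ := Quotient.mk''_surjective x
    obtain ⟨y, rfl⟩ := Quotient.mk''_surjective y
    exact map_add (freeLift f) x y
  map_mul' x y := by
    obtain ⟨x, rfl⟩ := Quotient.mk''_surjective x
    obtain ⟨y, rfl⟩ := Quotient.mk''_surjective y
    exact map_mul (freeLift f) x y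

theorem lift_mk_gen (f : LeavittPath.Generator V E → A)
    (hf : ∀ a b, LeavittPath.Rel K G a b → freeLift f a = freeLift f b)
    (x : LeavittPath.Generator V E) : lift f hf (mk K G (LeavittPath.gen K x)) = f x :=
  freeLift_gen f x

end UniversalProperty

/-! ### A graded representation in which all paths act non-trivially -/

/-- A branching system: a set `S` of labels such that, at every vertex which is not a sink, `S` is
the disjoint union of copies of `S` indexed by the edges emitted by that vertex. -/
structure Branching {V : Type u} {E : Type v} (G : DirectedGraph V E) (S : Type*) where
  /-- prolongation of a label by an edge -/
  cons : E → S → S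
  /-- removal of an edge from a label -/
  uncons : E → S → Option S
  uncons_cons (e : E) (x : S) : uncons e (cons e x) = some x
  uncons_cons_of_ne (e f : E) (h : e ≠ f) (hs : G.s e = G.s f) (x : S) : uncons e (cons f x) = none
  exists_cons (v : V) (hv : (G.emitted v).Nonempty) (x : S) : ∃ e y, G.s e = v ∧ cons e y = x

theorem exists_branching {V : Type u} {E : Type v} (G : DirectedGraph V E) :
    Nonempty (Branching G (E ⊕ ℕ)) := by
  classical
  have key : ∀ v, (G.emitted v).Nonempty → Nonempty ((G.emitted v) × (E ⊕ ℕ) ≃ (E ⊕ ℕ)) := by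
    intro v hv
    have := hv.to_subtype
    rw [← Cardinal.eq, Cardinal.mk_prod, Cardinal.lift_id, Cardinal.lift_id]
    -- The summand `ℕ` makes the label set infinite and the summand `E` makes it at least as large
    -- as any set of emitted edges, so one label set serves all vertices.
    refine Cardinal.mul_eq_right (Cardinal.aleph0_le_mk _) ?_ (Cardinal.mk_ne_zero _)
    exact Cardinal.mk_le_of_injective (f := fun e => Sum.inl e.1)
      fun a b h => Subtype.ext (Sum.inl_injective h)
  have φ := fun v (hv : (G.emitted v).Nonempty) => (key v hv).some
  have hne : ∀ e : E, (G.emitted (G.s e)).Nonempty := fun e => ⟨e, rfl⟩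
  -- The bijection depends on the source of the edge; this replaces that source by an equal vertex.
  have hcons : ∀ (e : E) (v : V) (hv : (G.emitted v).Nonempty) (h : G.s e = v) (x),
      φ (G.s e) (hne e) (⟨e, rfl⟩, x) = φ v hv (⟨e, h⟩, x) := by
    rintro e v hv rfl x; rfl
  refine ⟨⟨fun e x => φ (G.s e) (hne e) (⟨e, rfl⟩, x),
    fun e x => if ((φ (G.s e) (hne e)).symm x).1.1 = e then
      some ((φ (G.s e) (hne e)).symm x).2 else none, ?_, ?_, ?_⟩⟩
  · intro e x; simp
  · intro e f h hs x
    rw [hcons f (G.s e) (hne e) hs.symm, Equiv.symm_apply_apply, if_neg (Ne.symm h)]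
  · intro v hv x
    refine ⟨((φ v hv).symm x).1.1, ((φ v hv).symm x).2, ((φ v hv).symm x).1.2, ?_⟩
    rw [hcons _ v hv ((φ v hv).symm x).1.2]
    exact (φ v hv).apply_symm_apply x

section Representation

variable {V : Type u} {E : Type v} (K : Type w) [Field K] {X : Type*}

/-- The operator on the free module on `X` induced by a partial map. -/
noncomputable def partialOp (f : X → Option X) : Module.End K (X →₀ K) :=
  Finsupp.linearCombination K fun x => (f x).elim 0 fun y => Finsupp.single y 1

theorem partialOp_single (f : X → Option X) (x : X) :
    partialOp K f (Finsupp.single x 1) = (f x).elim 0 fun y => Finsupp.single y 1 := by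
  simp [partialOp]

theorem partialOp_mul (f g : X → Option X) :
    partialOp K f * partialOp K g = partialOp K fun x => (g x).bind f := by
  refine Finsupp.lhom_ext' fun x => LinearMap.ext_ring ?_
  simp only [Module.End.mul_apply, LinearMap.comp_apply, Finsupp.lsingle_apply, partialOp_single]
  cases g x with
  | none => simp
  | some y => simp [partialOp_single]

variable {S : Type*} {G : DirectedGraph V E} (B : Branching G S)

open Classical in
/-- The partial maps by which the generators act on labelled vertices with a degree. -/
noncomputable def action : LeavittPath.Generator V E → V × S × ℤ → Option (V × S × ℤ)
  | .vertex v => fun x => if x.1 = v then some x else none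
  | .edge e => fun x => if x.1 = G.r e then some (G.s e, B.cons e x.2.1, x.2.2 + 1) else none
  | .ghost e => fun x =>
    if x.1 = G.s e then (B.uncons e x.2.1).map fun y => (G.r e, y, x.2.2 - 1) else none

theorem action_rel (a b : LeavittPath.FreeAlg K V E) (h : LeavittPath.Rel K G a b) :
    freeLift (fun x => partialOp K (action B x)) a =
      freeLift (fun x => partialOp K (action B x)) b := by
  classical
  -- Zero is the operator of the nowhere defined map, so the relations with right side 0 also reduce
  -- to equalities of partial maps.
  have hz : partialOp K (fun _ : V × S × ℤ => none) = 0 := by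
    refine Finsupp.lhom_ext' fun x => LinearMap.ext_ring ?_
    simp [partialOp_single]
  cases h with
  | vertex_self v =>
    rw [map_mul, freeLift_gen, partialOp_mul]
    congr 1; funext x
    by_cases h : x.1 = v <;> simp [action, h]
  | vertex_ne v w h =>
    rw [map_mul, freeLift_gen, freeLift_gen, partialOp_mul, map_zero, ← hz]
    congr 1; funext x
    by_cases h' : x.1 = w
    · simp [action, h', h.symm]
    · simp [action, h']
  | source_edge e =>
    rw [map_mul, freeLift_gen, freeLift_gen, partialOp_mul]
    congr 1; funext x
    by_cases h : x.1 = G.r e <;> simp [action, h]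
  | edge_range e =>
    rw [map_mul, freeLift_gen, freeLift_gen, partialOp_mul]
    congr 1; funext x
    by_cases h : x.1 = G.r e <;> simp [action, h]
  | range_ghost e =>
    rw [map_mul, freeLift_gen, freeLift_gen, partialOp_mul]
    congr 1; funext x
    by_cases h : x.1 = G.s e
    · cases h' : B.uncons e x.2.1 <;> simp [action, h, h']
    · simp [action, h]
  | ghost_source e =>
    rw [map_mul, freeLift_gen, freeLift_gen, partialOp_mul]
    congr 1; funext x
    by_cases h : x.1 = G.s e <;> simp [action, h]
  | ck1_self e =>
    rw [map_mul, freeLift_gen, freeLift_gen, freeLift_gen, partialOp_mul]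
    congr 1; funext ⟨t, y, n⟩
    by_cases h : t = G.r e
    · subst h; simp [action, B.uncons_cons]
    · simp [action, h]
  | ck1_ne e f h =>
    rw [map_mul, freeLift_gen, freeLift_gen, partialOp_mul, map_zero, ← hz]
    congr 1; funext x
    by_cases h' : x.1 = G.r f
    · by_cases hs : G.s e = G.s f
      · simp [action, h', B.uncons_cons_of_ne e f h hs]
      · simp [action, h', Ne.symm hs]
    · simp [action, h']
  | ck2 v h =>
    rw [map_sum, freeLift_gen]
    simp_rw [map_mul, freeLift_gen, partialOp_mul]
    refine Finsupp.lhom_ext' fun x => LinearMap.ext_ring ?_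
    obtain ⟨t, y, n⟩ := x
    simp only [LinearMap.comp_apply, Finsupp.lsingle_apply, LinearMap.sum_apply, partialOp_single]
    by_cases ht : t = v
    · subst ht
      -- The label starts with exactly one edge emitted by `t`; only that summand survives.
      obtain ⟨e, z, rfl, rfl⟩ := B.exists_cons t h.2 y
      rw [Finset.sum_eq_single e]
      · simp [action, B.uncons_cons]
      · intro f hf hfe
        have hs : G.s f = G.s e := by simpa [DirectedGraph.emitted] using hf
        simp [action, hs, B.uncons_cons_of_ne f e hfe hs]
      · intro he
        exact absurd (h.1.mem_toFinset.2 rfl) he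
    · rw [Finset.sum_eq_zero]
      · simp [action, ht]
      · intro f hf
        have hs : G.s f = v := by simpa [DirectedGraph.emitted] using hf
        simp [action, hs, ht]

/-- The representation of the Leavitt path algebra given by a branching system. -/
noncomputable def rep : LeavittPathAlgebra K G →ₙₐ[K] Module.End K (V × S × ℤ →₀ K) :=
  lift (fun x => partialOp K (action B x)) (action_rel K B)

/-- The third coordinate records length, which is all that is needed to tell paths apart; the
resulting label is irrelevant. -/
theorem rep_path {u v : V} {μ : List E} (h : G.IsPath u μ v) (x : S) (n : ℤ) :
    ∃ y, rep K B (path K G u μ) (Finsupp.single (v, x, n) 1) =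
      Finsupp.single (u, y, n + μ.length) 1 := by
  classical
  induction μ generalizing u with
  | nil =>
    obtain rfl : u = v := h
    refine ⟨x, ?_⟩
    rw [path, vertex, rep, lift_mk_gen, partialOp_single]
    simp [action]
  | cons e μ ih =>
    obtain ⟨y, hy⟩ := ih h.2
    obtain ⟨rfl, -⟩ := h
    refine ⟨B.cons e y, ?_⟩
    rw [path, map_mul, Module.End.mul_apply, hy, edge, rep, lift_mk_gen, partialOp_single]
    simp [action, add_assoc]

end Representation

section

variable {V : Type u} {E : Type v} {K : Type w} [Field K] {G : DirectedGraph V E}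

theorem vertex_ne_zero (v : V) : vertex K G v ≠ 0 := by
  obtain ⟨B⟩ := exists_branching G
  obtain ⟨y, hy⟩ := rep_path K B (u := v) (v := v) (μ := []) rfl (.inr 0) 0
  intro h
  rw [path, h, map_zero, LinearMap.zero_apply] at hy
  exact Finsupp.single_ne_zero.2 one_ne_zero hy.symm

/-- Paths of pairwise different lengths from `u` to `v` are linearly independent. -/
theorem linearIndependent_path {u v : V} (μ : ℕ → List E) (h : ∀ i, G.IsPath u (μ i) v)
    (hl : Function.Injective fun i => (μ i).length) :
    LinearIndependent K fun i => path K G u (μ i) := by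
  obtain ⟨B⟩ := exists_branching G
  choose y hy using fun i => rep_path K B (h i) (.inr 0) 0
  -- Evaluation at one basis vector sends the paths to basis vectors of different degrees.
  let φ : LeavittPathAlgebra K G →ₗ[K] (V × (E ⊕ ℕ) × ℤ →₀ K) :=
    (LinearMap.applyₗ (Finsupp.single (v, .inr 0, 0) 1)) ∘ₗ
      { toFun := rep K B, map_add' := map_add _, map_smul' := map_smul _ }
  refine LinearIndependent.of_comp φ ?_
  have hφ : φ ∘ (fun i => path K G u (μ i)) =
      (fun x => Finsupp.single x (1 : K)) ∘ fun i => (u, y i, 0 + ((μ i).length : ℤ)) :=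
    funext fun i => hy i
  rw [hφ]
  refine (Finsupp.linearIndependent_single_one K _).comp _ fun i j hij => hl ?_
  simpa using (Prod.ext_iff.1 (Prod.ext_iff.1 hij).2).2

/-! ### Consequences of primeness -/

/-- Every element is a left multiple of itself by a finite sum of vertices. -/
theorem exists_finset_sum_mul (a : LeavittPathAlgebra K G) :
    ∃ F : Finset V, ∀ F', F ⊆ F' → ∑ v ∈ F', vertex K G v * a = a := by
  classical
  induction a using induction_on with
  | zero => exact ⟨∅, by simp⟩
  | add a b ha hb =>
    obtain ⟨F₁, h₁⟩ := ha
    obtain ⟨F₂, h₂⟩ := hb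
    refine ⟨F₁ ∪ F₂, fun F' h => ?_⟩
    simp_rw [mul_add]
    rw [Finset.sum_add_distrib, h₁ F' (Finset.union_subset_left h),
      h₂ F' (Finset.union_subset_right h)]
  | smul k a ha =>
    obtain ⟨F, h⟩ := ha
    refine ⟨F, fun F' hF => ?_⟩
    simp_rw [mul_smul_comm]
    rw [← Finset.smul_sum, h F' hF]
  | monomial u v w α β hα hβ =>
    refine ⟨{u}, fun F' hF => ?_⟩
    rw [Finset.sum_eq_single u]
    · rw [← mul_assoc, source_mul_path K hα]
    · intro t _ ht
      rw [← mul_assoc, vertex_mul_path_of_ne K hα ht, zero_mul]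
    · exact fun h => absurd (Finset.singleton_subset_iff.1 hF) h

/-- Take the ideal `J` of all `y` with `a s y = 0` for every `s`, and the ideal `I` of all `x` with
`x s y = 0` for every `s` and every `y ∈ J`. Then `a ∈ I` and `b ∈ J`. Without a unit, `I J = 0`
needs local units: `y` is a finite sum of elements `v y`, and `x v y = 0`. -/
theorem eq_zero_or_eq_zero_of_isPrimeAlgebra (hp : IsPrimeAlgebra (LeavittPathAlgebra K G))
    {a b : LeavittPathAlgebra K G} (h : ∀ s, a * s * b = 0) : a = 0 ∨ b = 0 := by
  let J : TwoSidedIdeal (LeavittPathAlgebra K G) := .mk' {y | ∀ s, a * s * y = 0}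
    (fun s => mul_zero _) (fun hx hy s => by rw [mul_add, hx s, hy s, add_zero])
    (fun hx s => by rw [mul_neg, hx s, neg_zero])
    (fun {x y} hy s => by rw [← mul_assoc, mul_assoc a, hy])
    (fun {x y} hx s => by rw [← mul_assoc, hx s, zero_mul])
  have hJ : ∀ y, y ∈ J ↔ ∀ s, a * s * y = 0 := TwoSidedIdeal.mem_mk' _ _ _ _ _ _
  let I : TwoSidedIdeal (LeavittPathAlgebra K G) := .mk' {x | ∀ y ∈ J, ∀ s, x * s * y = 0}
    (fun y _ s => by rw [zero_mul, zero_mul])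
    (fun hx hx' y hy s => by rw [add_mul, add_mul, hx y hy s, hx' y hy s, add_zero])
    (fun hx y hy s => by rw [neg_mul, neg_mul, hx y hy s, neg_zero])
    (fun {x x'} hx y hy s => by rw [mul_assoc, mul_assoc, ← mul_assoc x', hx y hy s, mul_zero])
    (fun {x x'} hx y hy s => by rw [mul_assoc x, hx y hy])
  have hI : ∀ x, x ∈ I ↔ ∀ y ∈ J, ∀ s, x * s * y = 0 := TwoSidedIdeal.mem_mk' _ _ _ _ _ _
  have hIJ : ∀ x ∈ I, ∀ y ∈ J, x * y = 0 := by
    intro x hx y hy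
    obtain ⟨F, hF⟩ := exists_finset_sum_mul y
    rw [← hF F subset_rfl, Finset.mul_sum]
    exact Finset.sum_eq_zero fun v _ => by rw [← mul_assoc]; exact (hI x).1 hx y hy _
  rcases hp.2 I J hIJ with h0 | h0
  · left
    have : a ∈ I := (hI a).2 fun y hy => (hJ y).1 hy
    rwa [h0, TwoSidedIdeal.mem_bot] at this
  · right
    have : b ∈ J := (hJ b).2 h
    rwa [h0, TwoSidedIdeal.mem_bot] at this

end

end LeavittPathAlgebra

namespace DirectedGraph

variable {V : Type u} {E : Type v} {G : DirectedGraph V E}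

/-! ### Infinite paths and closed paths -/

/-- The finite piece `f_i ⋯ f_{i+n-1}` of a sequence of edges. -/
def segment (f : ℕ → E) (i n : ℕ) : List E := (List.range n).map fun k => f (i + k)

theorem length_segment (f : ℕ → E) (i n : ℕ) : (segment f i n).length = n := by
  simp [segment]

theorem getElem?_segment (f : ℕ → E) (i : ℕ) {n k : ℕ} (h : k < n) :
    (segment f i n)[k]? = some (f (i + k)) := by
  simp [segment, h]

theorem IsInfinitePath.isPath_segment {f : ℕ → E} (h : G.IsInfinitePath f) (i n : ℕ) :
    G.IsPath (G.s (f i)) (segment f i n) (G.s (f (i + n))) := by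
  induction n with
  | zero => rfl
  | succ n ih =>
    rw [segment, List.range_succ, List.map_append]
    exact ih.append ⟨rfl, h _⟩

theorem exists_infinitePath {B : Set V} (hB : ∀ v ∈ B, ∃ e, G.s e = v ∧ G.r e ∈ B) {v : V}
    (hv : v ∈ B) : ∃ f : ℕ → E, G.IsInfinitePath f ∧ ∀ i, G.s (f i) ∈ B := by
  choose g hg using fun v : B => hB v v.2
  let t : ℕ → B := fun n => Nat.rec ⟨v, hv⟩ (fun _ w => ⟨G.r (g w), (hg w).2⟩) n
  refine ⟨fun n => g (t n), fun i => ?_, fun i => ?_⟩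
  · exact ((hg (t (i + 1))).1).symm
  · rw [(hg (t i)).1]; exact (t i).2

theorem IsPath.range_getElem {u v : V} {μ : List E} (h : G.IsPath u μ v) {i : ℕ}
    (hi : i + 1 < μ.length) : G.r μ[i] = G.s μ[i + 1] := by
  induction μ generalizing u i with
  | nil => simp at hi
  | cons e μ ih =>
    cases i with
    | zero =>
      cases μ with
      | nil => simp at hi
      | cons f μ => exact h.2.1.symm
    | succ i => exact ih h.2 (by simpa using hi)

theorem IsPath.range_getElem_last {u v : V} {μ : List E} (h : G.IsPath u μ v) {i : ℕ}
    (hi : i + 1 = μ.length) : G.r μ[i] = v := by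
  induction μ generalizing u i with
  | nil => simp at hi
  | cons e μ ih =>
    cases i with
    | zero =>
      obtain rfl : μ = [] := List.eq_nil_of_length_eq_zero (by simpa using hi.symm)
      exact h.2
    | succ i => exact ih h.2 (by simpa using hi)

theorem IsPath.source_getElem_zero {u v : V} {μ : List E} (h : G.IsPath u μ v)
    (hi : 0 < μ.length) : G.s μ[0] = u := by
  cases μ with
  | nil => simp at hi
  | cons e μ => exact h.1

theorem IsPath.isInfinitePath_mod {v : V} {d : List E} (h : G.IsPath v d v) (hd : 0 < d.length) :
    G.IsInfinitePath fun i => d[i % d.length]'(Nat.mod_lt _ hd) := by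
  intro i
  have hlt := Nat.mod_lt i hd
  by_cases hi : i % d.length + 1 < d.length
  · have : (i + 1) % d.length = i % d.length + 1 := by
      rw [Nat.add_mod, Nat.mod_eq_of_lt (a := 1) (by omega), Nat.mod_eq_of_lt hi]
    simp only [this]
    exact h.range_getElem hi
  · have hi' : i % d.length + 1 = d.length := by omega
    have : (i + 1) % d.length = 0 := by
      rw [← Nat.mod_add_mod, hi', Nat.mod_self]
    simp only [this]
    rw [h.range_getElem_last hi', h.source_getElem_zero hd]

theorem EndsIn.of_isRotated {f : ℕ → E} {c d : List E} (h : EndsIn f d) (hcd : d.IsRotated c)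
    (hd : d ≠ []) : EndsIn f c := by
  obtain ⟨m, rfl⟩ := hcd
  obtain ⟨N, hN⟩ := h
  -- Rotation by `m` only delays the start of the periodic part by `m`.
  refine ⟨N + m, fun i => ?_⟩
  rw [List.length_rotate, List.getElem?_rotate (Nat.mod_lt _ (List.length_pos_iff.2 hd)),
    Nat.mod_add_mod, hN, add_assoc, add_comm m]

theorem IsCycle.exists_rotated {c : List E} (hc : G.IsCycle c) {e : E} (he : e ∈ c) :
    ∃ c', c.IsRotated (e :: c') ∧ G.IsCycle (e :: c') ∧ G.IsPath (G.s e) (e :: c') (G.s e) := by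
  obtain ⟨a, b, rfl⟩ := List.append_of_mem he
  obtain ⟨-, ⟨v, hv⟩, hn⟩ := hc
  obtain ⟨w, h1, h2⟩ := hv.split
  obtain rfl : G.s e = w := h2.1
  have hrot : (a ++ e :: b).IsRotated (e :: (b ++ a)) := by
    rw [← List.cons_append]; exact List.isRotated_append
  have hp : G.IsPath (G.s e) (e :: (b ++ a)) (G.s e) := IsPath.append h2 h1
  exact ⟨b ++ a, hrot, ⟨by simp, ⟨_, hp⟩, (hrot.map G.s).nodup_iff.1 hn⟩, hp⟩

theorem IsCycle.eq_of_source_eq {c : List E} (hc : G.IsCycle c) {e f : E} (he : e ∈ c) (hf : f ∈ c)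
    (h : G.s e = G.s f) : e = f :=
  List.inj_on_of_nodup_map hc.2.2 he hf h

/-! ### Cycles without exits -/

/-- A set of vertices that is closed under ranges and all of whose vertices emit at most one
edge. -/
structure IsDeterministic (G : DirectedGraph V E) (D : Set V) : Prop where
  range_mem (e : E) : G.s e ∈ D → G.r e ∈ D
  eq_of_source_eq (e f : E) : G.s e ∈ D → G.s e = G.s f → e = f

theorem IsDeterministic.mem_of_isPath {D : Set V} (hD : G.IsDeterministic D) {u v : V} (hu : u ∈ D)
    {μ : List E} (h : G.IsPath u μ v) : v ∈ D := by
  induction μ generalizing u with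
  | nil => obtain rfl : u = v := h; exact hu
  | cons e μ ih => obtain ⟨rfl, h⟩ := h; exact ih (hD.range_mem e hu) h

theorem IsDeterministic.prefix_or_prefix {D : Set V} (hD : G.IsDeterministic D) {u v w : V}
    (hu : u ∈ D) {μ ν : List E} (hμ : G.IsPath u μ v) (hν : G.IsPath u ν w) :
    μ <+: ν ∨ ν <+: μ := by
  induction μ generalizing u ν with
  | nil => exact .inl List.nil_prefix
  | cons e μ ih =>
    cases ν with
    | nil => exact .inr List.nil_prefix
    | cons f ν =>
      obtain ⟨rfl, hμ⟩ := hμ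
      obtain ⟨hf, hν⟩ := hν
      obtain rfl := hD.eq_of_source_eq e f hu hf.symm
      simpa using ih (hD.range_mem e hu) hμ hν

/-- A cycle has no exit if no edge outside of the cycle starts at a vertex of the cycle. -/
def HasNoExit (G : DirectedGraph V E) (c : List E) : Prop :=
  ∀ e ∈ c, ∀ f, G.s f = G.s e → f ∈ c

theorem IsCycle.source_next_mem {c : List E} (hc : G.IsCycle c) {e : E} (he : e ∈ c) :
    ∃ f ∈ c, G.s f = G.r e := by
  obtain ⟨c', hr, -, hp⟩ := hc.exists_rotated he
  cases c' with
  | nil => exact ⟨e, he, hp.2.symm⟩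
  | cons f c' => exact ⟨f, hr.mem_iff.2 (by simp), hp.2.1⟩

theorem IsCycle.isDeterministic {c : List E} (hc : G.IsCycle c) (h : G.HasNoExit c) :
    G.IsDeterministic {v | ∃ e ∈ c, G.s e = v} where
  range_mem := by
    rintro e ⟨f, hf, hfe⟩
    exact hc.source_next_mem (h f hf e hfe.symm)
  eq_of_source_eq := by
    rintro e f ⟨g, hg, hge⟩ hef
    exact hc.eq_of_source_eq (h g hg e hge.symm) (h g hg f (by rw [hge, hef])) hef

/-- In a cycle, a nonempty initial closed path is the whole cycle. -/
theorem IsCycle.eq_nil_of_append {c x : List E} {u : V} (hc : G.IsCycle (c ++ x)) (hne : c ≠ [])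
    (h₁ : G.IsPath u c u) (h₂ : G.IsPath u x u) : x = [] := by
  cases x with
  | nil => rfl
  | cons e x =>
    cases c with
    | nil => exact absurd rfl hne
    | cons f c =>
      have := hc.2.2
      simp only [List.cons_append, List.map_cons, List.map_append, List.nodup_cons] at this
      -- Both closed pieces would begin with an edge of source `u`, but the sources in a cycle are
      -- distinct.
      exact absurd (by simp [h₁.1, h₂.1]) this.1

theorem IsCycle.eq_of_isPath {c d : List E} {u : V} (hc : G.IsCycle c) (hd : G.IsCycle d)
    {D : Set V} (hD : G.IsDeterministic D) (hu : u ∈ D) (h₁ : G.IsPath u c u)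
    (h₂ : G.IsPath u d u) : c = d := by
  rcases hD.prefix_or_prefix hu h₁ h₂ with ⟨x, rfl⟩ | ⟨x, rfl⟩
  · obtain ⟨w, h3, h4⟩ := h₂.split
    obtain rfl := h₁.range_unique h3
    rw [hd.eq_nil_of_append hc.1 h₁ h4, List.append_nil]
  · obtain ⟨w, h3, h4⟩ := h₁.split
    obtain rfl := h₂.range_unique h3
    rw [hc.eq_nil_of_append hd.1 h₂ h4, List.append_nil]

/-- Two cycles without exits that share a vertex agree up to rotation. -/
theorem IsCycle.isRotated_of_source_eq {c d : List E} (hc : G.IsCycle c) (hd : G.IsCycle d)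
    (hx : G.HasNoExit c) {e f : E} (he : e ∈ c) (hf : f ∈ d) (h : G.s e = G.s f) :
    c.IsRotated d := by
  obtain rfl : e = f := (hc.isDeterministic hx).eq_of_source_eq e f ⟨e, he, rfl⟩ h
  obtain ⟨c', hr, hc', hp⟩ := hc.exists_rotated he
  obtain ⟨d', hr', hd', hp'⟩ := hd.exists_rotated hf
  have := hc'.eq_of_isPath hd' (hc.isDeterministic hx) ⟨e, he, rfl⟩ hp hp'
  rw [this] at hr
  exact hr.trans hr'.symm

/-- An infinite path with a repeated vertex ends in a cycle, if cycles have no exits. -/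
theorem IsInfinitePath.exists_endsIn {f : ℕ → E} (hf : G.IsInfinitePath f)
    (hx : ∀ c, G.IsCycle c → G.HasNoExit c) (h : ∃ m i, 0 < m ∧ G.s (f i) = G.s (f (i + m))) :
    ∃ c, G.IsCycle c ∧ EndsIn f c := by
  classical
  -- The repetition distance `m` is taken minimal over all positions, so the sources within the
  -- segment are distinct and the segment is a cycle.
  obtain ⟨i, hm, hi⟩ := Nat.find_spec h
  have hmin := fun k => Nat.find_min h (m := k)
  set m := Nat.find h
  have hpath := hf.isPath_segment i m
  rw [← hi] at hpath
  have hc : G.IsCycle (segment f i m) := by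
    refine ⟨fun h0 => hm.ne ?_, ⟨_, hpath⟩, ?_⟩
    · rw [← length_segment f i m, h0]; rfl
    · rw [segment, List.map_map]
      have key : ∀ a b, a < b → b < m → G.s (f (i + a)) ≠ G.s (f (i + b)) := by
        intro a b hab hb hs
        refine hmin (b - a) (by omega) ⟨i + a, by omega, ?_⟩
        rwa [show i + a + (b - a) = i + b by omega]
      refine List.Nodup.map_on ?_ List.nodup_range
      intro a ha b hb hab
      rw [List.mem_range] at ha hb
      rcases lt_trichotomy a b with h' | h' | h'
      · exact absurd hab (key a b h' hb)
      · exact h'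
      · exact absurd hab.symm (key b a h' ha)
  have hmem : ∀ k < m, f (i + k) ∈ segment f i m := fun k hk =>
    List.mem_iff_getElem?.2 ⟨k, getElem?_segment f i hk⟩
  have hD := hc.isDeterministic (hx _ hc)
  -- The cycle has no exit, so once on it the path is forced to go round.
  have hper : ∀ k, f (i + k % m) = f (i + k) := by
    intro k
    induction k with
    | zero => rw [Nat.zero_mod]
    | succ k ih =>
      have hlt := Nat.mod_lt k hm
      refine hD.eq_of_source_eq _ _ ⟨_, hmem _ (Nat.mod_lt _ hm), rfl⟩ ?_
      rw [← add_assoc i k 1, ← hf, ← ih, hf]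
      by_cases hk : k % m + 1 < m
      · rw [← Nat.mod_add_mod, Nat.mod_eq_of_lt hk, add_assoc]
      · have hk' : k % m + 1 = m := by omega
        rw [← Nat.mod_add_mod, hk', Nat.mod_self, add_zero, hi, add_assoc, hk']
  refine ⟨segment f i m, hc, i, fun k => ?_⟩
  rw [length_segment, getElem?_segment f i (Nat.mod_lt _ hm), hper]

/-! ### Aperiodic paths -/

/-- The path `μ` has length at least `N` and no periodicity starting before the position `N`. -/
def IsAperiodic (N : ℕ) (μ : List E) : Prop :=
  N ≤ μ.length ∧ ∀ p q, p < q → q ≤ N → ¬ μ.drop q <+: μ.drop p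

theorem IsAperiodic.mono {M N : ℕ} {μ : List E} (h : IsAperiodic N μ) (hMN : M ≤ N) :
    IsAperiodic M μ :=
  ⟨hMN.trans h.1, fun p q hpq hq => h.2 p q hpq (hq.trans hMN)⟩

theorem isAperiodic_of_getElem? {N : ℕ} {μ : List E}
    (h : ∀ p q, p < q → q ≤ N → ∃ j, q + j < μ.length ∧ μ[q + j]? ≠ μ[p + j]?)
    (hN : N ≤ μ.length) : IsAperiodic N μ := by
  refine ⟨hN, fun p q hpq hq hpre => ?_⟩
  obtain ⟨j, hj, hne⟩ := h p q hpq hq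
  have := List.prefix_iff_getElem?.1 hpre j (by rw [List.length_drop]; omega)
  rw [List.getElem?_drop, List.getElem_drop, ← List.getElem?_eq_getElem] at this
  exact hne this.symm

/-- Only finitely many pairs `p < q ≤ N` matter. A finite piece long enough to contain one
disagreement for each pair is aperiodic up to `N`. -/
theorem IsInfinitePath.exists_isAperiodic {f : ℕ → E} (hf : G.IsInfinitePath f)
    (h : ∀ p q, p < q → ∃ j, f (q + j) ≠ f (p + j)) (N : ℕ) :
    ∃ μ w, G.IsPath (G.s (f 0)) μ w ∧ IsAperiodic N μ := by
  have h' : ∀ p q, ∃ j, p < q → f (q + j) ≠ f (p + j) := fun p q => by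
    by_cases hpq : p < q
    · obtain ⟨j, hj⟩ := h p q hpq; exact ⟨j, fun _ => hj⟩
    · exact ⟨0, fun h => absurd h hpq⟩
  choose J hJ using h'
  let b := (Finset.range (N + 1) ×ˢ Finset.range (N + 1)).sup fun x => J x.1 x.2
  have hb : ∀ p q, p < q → q ≤ N → J p q ≤ b := fun p q hpq hq =>
    Finset.le_sup (f := fun x : ℕ × ℕ => J x.1 x.2) (b := (p, q)) (by simp; omega)
  refine ⟨_, _, hf.isPath_segment 0 (N + b + 1), isAperiodic_of_getElem? (fun p q hpq hq => ?_) ?_⟩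
  · have := hb p q hpq hq
    refine ⟨J p q, by rw [length_segment]; omega, ?_⟩
    rw [getElem?_segment f 0 (by omega), getElem?_segment f 0 (by omega), zero_add, zero_add]
    exact fun h => hJ p q hpq (Option.some_injective _ h)
  · rw [length_segment]; omega

/-- The path `cc⋯c` (`n` times). -/
def listPow (c : List E) (n : ℕ) : List E := (List.replicate n c).flatten

theorem listPow_succ (c : List E) (n : ℕ) : listPow c (n + 1) = c ++ listPow c n := by
  rw [listPow, List.replicate_succ, List.flatten_cons, listPow]

theorem length_listPow (c : List E) (n : ℕ) : (listPow c n).length = n * c.length := by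
  simp [listPow]

theorem isPath_listPow {u : V} {c : List E} (h : G.IsPath u c u) (n : ℕ) :
    G.IsPath u (listPow c n) u := by
  induction n with
  | zero => rfl
  | succ n ih => rw [listPow_succ]; exact h.append ih

/-- The path `d⋯d e`, with `N` copies of `d`, works: `e` occurs only at the end, so no shift of the
path matches it there. -/
theorem IsPath.exists_isAperiodic_of_exit {u : V} {d : List E} (h : G.IsPath u d u) (hd : d ≠ [])
    {e : E} (he : e ∉ d) (hs : G.s e = u) (N : ℕ) :
    ∃ μ w, G.IsPath u μ w ∧ IsAperiodic N μ := by
  have hlen : N ≤ (listPow d N).length := by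
    rw [length_listPow]
    exact Nat.le_mul_of_pos_right N (List.length_pos_iff.2 hd)
  refine ⟨listPow d N ++ [e], G.r e, (isPath_listPow h N).append ⟨hs, rfl⟩,
    isAperiodic_of_getElem? (fun p q hpq hq => ?_) ?_⟩
  · refine ⟨(listPow d N).length - q, ?_, ?_⟩
    · rw [List.length_append, List.length_singleton]; omega
    · rw [show q + ((listPow d N).length - q) = (listPow d N).length by omega,
        List.getElem?_append_left (i := p + _) (by omega), List.getElem?_concat_length]
      intro h0
      obtain ⟨l, hl, hel⟩ := List.mem_flatten.1 (List.mem_iff_getElem?.2 ⟨_, h0.symm⟩)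
      exact he ((List.eq_of_mem_replicate hl) ▸ hel)
  · rw [List.length_append]; omega

end DirectedGraph

open DirectedGraph

namespace LeavittPathAlgebra

variable {V : Type u} {E : Type v} {K : Type w} [Field K] {G : DirectedGraph V E}

/-! ### Compressions by paths -/

/-- The product vanishes unless `α` and `β` are both prefixes of `μ`. Then it is `μ₁* μ₂` for the
two remaining tails: equal tails give `w`, and tails of different lengths are incomparable by
aperiodicity and give 0. -/
theorem exists_compress_monomial {v w u₁ u₂ x : V} {μ α β : List E} {N : ℕ} (hμ : G.IsPath v μ w)
    (hN : IsAperiodic N μ) (hα : G.IsPath u₁ α x) (hβ : G.IsPath u₂ β x) (hαN : α.length ≤ N)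
    (hβN : β.length ≤ N) :
    ∃ k : K, ghostPath K G v μ * (path K G u₁ α * ghostPath K G u₂ β) * path K G v μ =
      k • vertex K G w := by
  have hassoc : ghostPath K G v μ * (path K G u₁ α * ghostPath K G u₂ β) * path K G v μ =
      (ghostPath K G v μ * path K G u₁ α) * (ghostPath K G u₂ β * path K G v μ) := by
    simp only [mul_assoc]
  have hpre : ∀ γ : List E, γ.length ≤ N → ¬ γ <+: μ → ¬ μ <+: γ := fun γ hγ h h' =>
    h (h'.eq_of_length_le (hγ.trans hN.1) ▸ List.prefix_rfl)
  by_cases h₁ : u₁ = v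
  swap
  · refine ⟨0, ?_⟩
    rw [hassoc, ← ghostPath_mul_source K hμ, mul_assoc (ghostPath K G v μ) (vertex K G v),
      vertex_mul_path_of_ne K hα (Ne.symm h₁), mul_zero, zero_mul, zero_smul]
  by_cases h₂ : u₂ = v
  swap
  · refine ⟨0, ?_⟩
    rw [hassoc, ← source_mul_path K hμ, ← mul_assoc (ghostPath K G u₂ β),
      ghostPath_mul_vertex_of_ne K hβ (Ne.symm h₂), zero_mul, mul_zero, zero_smul]
  subst h₁ h₂
  by_cases hα' : α <+: μ
  swap
  · refine ⟨0, ?_⟩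
    rw [hassoc, ghostPath_mul_path_eq_zero K hμ hα (hpre _ hαN hα') hα', zero_mul, zero_smul]
  by_cases hβ' : β <+: μ
  swap
  · refine ⟨0, ?_⟩
    rw [hassoc, ghostPath_mul_path_eq_zero K hβ hμ hβ' (hpre _ hβN hβ'), mul_zero, zero_smul]
  obtain ⟨μ₁, h₁⟩ := hα'
  obtain ⟨μ₂, h₂⟩ := hβ'
  obtain ⟨x', h₃, hμ₁⟩ := (h₁ ▸ hμ : G.IsPath _ (α ++ μ₁) w).split
  obtain rfl := hα.range_unique h₃
  obtain ⟨x', h₄, hμ₂⟩ := (h₂ ▸ hμ : G.IsPath _ (β ++ μ₂) w).split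
  obtain rfl := hβ.range_unique h₄
  have e₁ : ghostPath K G u₂ μ * path K G u₂ α = ghostPath K G x μ₁ := by
    rw [← h₁, ghostPath_append_mul_path K hα hμ₁]
  have e₂ : ghostPath K G u₂ β * path K G u₂ μ = path K G x μ₂ := by
    rw [← h₂, ghostPath_mul_path_append K hβ hμ₂]
  have d₁ : μ.drop α.length = μ₁ := by rw [← h₁, List.drop_left]
  have d₂ : μ.drop β.length = μ₂ := by rw [← h₂, List.drop_left]
  have hlen₁ : α.length + μ₁.length = μ.length := by rw [← h₁, List.length_append]
  have hlen₂ : β.length + μ₂.length = μ.length := by rw [← h₂, List.length_append]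
  rw [hassoc, e₁, e₂]
  rcases lt_trichotomy α.length β.length with h | h | h
  · refine ⟨0, ?_⟩
    rw [zero_smul]
    -- The longer tail is no prefix of the shorter one by length; the other direction is
    -- aperiodicity.
    refine ghostPath_mul_path_eq_zero K hμ₁ hμ₂ (fun h' => ?_) (d₁ ▸ d₂ ▸ hN.2 _ _ h hβN)
    have := h'.length_le
    omega
  · refine ⟨1, ?_⟩
    have : μ₁ = μ₂ := by rw [← d₁, ← d₂, h]
    rw [← this, ghostPath_mul_path K hμ₁, one_smul]
  · refine ⟨0, ?_⟩
    rw [zero_smul]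
    refine ghostPath_mul_path_eq_zero K hμ₁ hμ₂ (d₁ ▸ d₂ ▸ hN.2 _ _ h hαN) (fun h' => ?_)
    have := h'.length_le
    omega

theorem exists_compress_of_isAperiodic (a : LeavittPathAlgebra K G) :
    ∃ N, ∀ v w μ, G.IsPath v μ w → IsAperiodic N μ →
      ∃ k : K, ghostPath K G v μ * a * path K G v μ = k • vertex K G w := by
  induction a using induction_on with
  | zero => exact ⟨0, fun v w μ _ _ => ⟨0, by rw [mul_zero, zero_mul, zero_smul]⟩⟩
  | add a b ha hb =>
    obtain ⟨N₁, h₁⟩ := ha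
    obtain ⟨N₂, h₂⟩ := hb
    refine ⟨max N₁ N₂, fun v w μ hμ hN => ?_⟩
    obtain ⟨k₁, hk₁⟩ := h₁ v w μ hμ (hN.mono (le_max_left _ _))
    obtain ⟨k₂, hk₂⟩ := h₂ v w μ hμ (hN.mono (le_max_right _ _))
    exact ⟨k₁ + k₂, by rw [mul_add, add_mul, hk₁, hk₂, add_smul]⟩
  | smul k a ha =>
    obtain ⟨N, h⟩ := ha
    refine ⟨N, fun v w μ hμ hN => ?_⟩
    obtain ⟨l, hl⟩ := h v w μ hμ hN
    exact ⟨k * l, by rw [mul_smul_comm, smul_mul_assoc, hl, mul_smul]⟩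
  | monomial u₁ u₂ x α β hα hβ =>
    exact ⟨max α.length β.length, fun v w μ hμ hN =>
      exists_compress_monomial hμ hN hα hβ (le_max_left _ _) (le_max_right _ _)⟩

/-- An edge that occurs in none of the finitely many monomials of `a` kills all of them except the
vertices. An infinite emitter always emits such an edge. -/
theorem exists_compress_edge (a : LeavittPathAlgebra K G) :
    ∃ F : Finset E, ∀ e ∉ F, ∃ k : K,
      ghostPath K G (G.s e) [e] * a * path K G (G.s e) [e] = k • vertex K G (G.r e) := by
  classical
  induction a using induction_on with
  | zero => exact ⟨∅, fun e _ => ⟨0, by rw [mul_zero, zero_mul, zero_smul]⟩⟩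
  | add a b ha hb =>
    obtain ⟨F₁, h₁⟩ := ha
    obtain ⟨F₂, h₂⟩ := hb
    refine ⟨F₁ ∪ F₂, fun e he => ?_⟩
    rw [Finset.notMem_union] at he
    obtain ⟨k₁, hk₁⟩ := h₁ e he.1
    obtain ⟨k₂, hk₂⟩ := h₂ e he.2
    exact ⟨k₁ + k₂, by rw [mul_add, add_mul, hk₁, hk₂, add_smul]⟩
  | smul k a ha =>
    obtain ⟨F, h⟩ := ha
    refine ⟨F, fun e he => ?_⟩
    obtain ⟨l, hl⟩ := h e he
    exact ⟨k * l, by rw [mul_smul_comm, smul_mul_assoc, hl, mul_smul]⟩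
  | monomial u₁ u₂ x α β hα hβ =>
    refine ⟨α.toFinset ∪ β.toFinset, fun e he => ?_⟩
    simp only [Finset.mem_union, List.mem_toFinset, not_or] at he
    have hp : G.IsPath (G.s e) [e] (G.r e) := ⟨rfl, rfl⟩
    cases α with
    | nil =>
      cases β with
      | nil =>
        -- Both paths are trivial, so `N = 0` suffices, where aperiodicity is vacuous.
        refine exists_compress_monomial (N := 0) hp ⟨Nat.zero_le _, fun p q h h' => ?_⟩ hα hβ
          le_rfl le_rfl
        omega
      | cons f β =>
        refine ⟨0, ?_⟩
        have hef : f ≠ e := fun h => he.2 (by simp [h])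
        rw [zero_smul, ghostPath.eq_def _ _ _ (f :: β), path.eq_def _ _ _ [e]]
        simp only [mul_assoc]
        rw [← mul_assoc (ghost K G f), ghost_mul_edge_of_ne K G hef, zero_mul, mul_zero, mul_zero,
          mul_zero]
    | cons f α =>
      refine ⟨0, ?_⟩
      have hef : e ≠ f := fun h => he.1 (by simp [h])
      rw [zero_smul, ghostPath, path.eq_def _ _ _ (f :: α)]
      simp only [mul_assoc]
      rw [← mul_assoc (ghost K G e), ghost_mul_edge_of_ne K G hef, zero_mul, mul_zero]

theorem exists_compress_sink {v : V} (hv : ¬ (G.emitted v).Nonempty)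
    (a : LeavittPathAlgebra K G) :
    ∃ k : K, ghostPath K G v [] * a * path K G v [] = k • vertex K G v := by
  induction a using induction_on with
  | zero => exact ⟨0, by rw [mul_zero, zero_mul, zero_smul]⟩
  | add a b ha hb =>
    obtain ⟨k₁, hk₁⟩ := ha
    obtain ⟨k₂, hk₂⟩ := hb
    exact ⟨k₁ + k₂, by rw [mul_add, add_mul, hk₁, hk₂, add_smul]⟩
  | smul k a ha =>
    obtain ⟨l, hl⟩ := ha
    exact ⟨k * l, by rw [mul_smul_comm, smul_mul_assoc, hl, mul_smul]⟩
  | monomial u₁ u₂ x α β hα hβ =>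
    have key : ∀ {u y γ}, G.IsPath u γ y → u = v → γ = [] := by
      rintro u y (_ | ⟨e, γ⟩) h rfl
      · rfl
      · exact absurd ⟨e, h.1⟩ hv
    simp only [path, ghostPath]
    by_cases h₁ : u₁ = v
    · by_cases h₂ : u₂ = v
      · rw [key hα h₁, key hβ h₂]
        subst h₁ h₂
        exact ⟨1, by simp [path, ghostPath, vertex_mul_self]⟩
      · refine ⟨0, ?_⟩
        rw [mul_assoc, mul_assoc, ghostPath_mul_vertex_of_ne K hβ (Ne.symm h₂), mul_zero, mul_zero,
          zero_smul]
    · refine ⟨0, ?_⟩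
      rw [← mul_assoc, vertex_mul_path_of_ne K hα (Ne.symm h₁), zero_mul, zero_mul, zero_smul]

/-! ### The centroid -/

/-- An element of the centroid that vanishes at a vertex is zero. -/
theorem centroid_eq_zero (hp : IsPrimeAlgebra (LeavittPathAlgebra K G))
    {τ : Module.End K (LeavittPathAlgebra K G)}
    (hτ : τ ∈ algebraCentroid K (LeavittPathAlgebra K G)) {v : V} (h : τ (vertex K G v) = 0) :
    τ = 0 := by
  refine LinearMap.ext fun a => ?_
  refine (eq_zero_or_eq_zero_of_isPrimeAlgebra hp (b := vertex K G v) fun s => ?_).resolve_right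
    (vertex_ne_zero v)
  -- `τ(a) s v = τ(a s v) = a s τ(v) = 0`.
  rw [← (hτ a s).1, ← (hτ (a * s) _).1, (hτ (a * s) _).2, h, mul_zero]

theorem centroid_ext (hp : IsPrimeAlgebra (LeavittPathAlgebra K G))
    {σ τ : algebraCentroid K (LeavittPathAlgebra K G)} (v : V)
    (h : σ.1 (vertex K G v) = τ.1 (vertex K G v)) : σ = τ := by
  have := centroid_eq_zero hp (σ - τ).2 (v := v) (by
    rw [AddSubgroupClass.coe_sub, LinearMap.sub_apply, h, sub_self])
  exact sub_eq_zero.1 (Subtype.ext this)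

/-- `μ* τ(v) μ = τ(μ* v μ) = τ(w)`, so a scalar compression exhibits a vertex on which `τ` is
scalar. -/
theorem exists_vertex_of_compress {τ : Module.End K (LeavittPathAlgebra K G)}
    (hτ : τ ∈ algebraCentroid K (LeavittPathAlgebra K G)) {v w : V} {μ : List E}
    (hμ : G.IsPath v μ w) {k : K}
    (h : ghostPath K G v μ * τ (vertex K G v) * path K G v μ = k • vertex K G w) :
    ∃ (w : V) (k : K), τ (vertex K G w) = k • vertex K G w := by
  refine ⟨w, k, ?_⟩
  rw [← h, ← (hτ _ _).2, ← (hτ _ _).1, ghostPath_mul_source K hμ, ghostPath_mul_path K hμ]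

theorem nonempty_centroid_equiv (hp : IsPrimeAlgebra (LeavittPathAlgebra K G))
    (h : ∀ τ ∈ algebraCentroid K (LeavittPathAlgebra K G),
      ∃ (w : V) (k : K), τ (vertex K G w) = k • vertex K G w) :
    Nonempty (algebraCentroid K (LeavittPathAlgebra K G) ≃ₐ[K] K) := by
  have := hp.1
  refine ⟨(AlgEquiv.ofBijective (Algebra.ofId K _) ⟨?_, fun τ => ?_⟩).symm⟩
  · exact (algebraMap K (algebraCentroid K (LeavittPathAlgebra K G))).injective
  · obtain ⟨w, k, hk⟩ := h τ τ.2
    exact ⟨k, centroid_ext hp w hk.symm⟩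

/-- Two cycles without exits agree up to rotation. -/
theorem isRotated_of_isPrimeAlgebra (hp : IsPrimeAlgebra (LeavittPathAlgebra K G))
    {c d : List E} (hc : G.IsCycle c) (hd : G.IsCycle d) (hcx : G.HasNoExit c)
    (hdx : G.HasNoExit d) : c.IsRotated d := by
  by_contra hcd
  obtain ⟨e, he⟩ := List.exists_mem_of_ne_nil c hc.1
  obtain ⟨f, hf⟩ := List.exists_mem_of_ne_nil d hd.1
  -- A surviving monomial `α β*` would have the common range of `α` and `β` on both cycles, as
  -- exitless cycles cannot be left.
  have key : ∀ a, vertex K G (G.s e) * a * vertex K G (G.s f) = 0 := by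
    intro a
    induction a using induction_on with
    | zero => rw [mul_zero, zero_mul]
    | add a b ha hb => rw [mul_add, add_mul, ha, hb, add_zero]
    | smul k a ha => rw [mul_smul_comm, smul_mul_assoc, ha, smul_zero]
    | monomial u₁ u₂ x α β hα hβ =>
      by_cases h₁ : G.s e = u₁
      · by_cases h₂ : G.s f = u₂
        · subst h₁ h₂
          obtain ⟨e', he', hex⟩ := (hc.isDeterministic hcx).mem_of_isPath ⟨e, he, rfl⟩ hα
          obtain ⟨f', hf', hfx⟩ := (hd.isDeterministic hdx).mem_of_isPath ⟨f, hf, rfl⟩ hβ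
          exact absurd (hc.isRotated_of_source_eq hd hcx he' hf' (hex.trans hfx.symm)) hcd
        · rw [mul_assoc, mul_assoc, ghostPath_mul_vertex_of_ne K hβ h₂, mul_zero, mul_zero]
      · rw [← mul_assoc, vertex_mul_path_of_ne K hα h₁, zero_mul, zero_mul]
  rcases eq_zero_or_eq_zero_of_isPrimeAlgebra hp key with h | h <;> exact vertex_ne_zero _ h

theorem nonempty_vertex [Nontrivial (LeavittPathAlgebra K G)] : Nonempty V := by
  by_contra hV
  obtain ⟨a, ha⟩ := exists_ne (0 : LeavittPathAlgebra K G)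
  obtain ⟨F, hF⟩ := exists_finset_sum_mul a
  refine ha ?_
  rw [← hF F subset_rfl]
  exact Finset.sum_eq_zero fun v _ => absurd ⟨v⟩ hV

/-- If the centroid contains more than the scalars, then the graph is a row-finite comet. -/
theorem isComet_of_centroid (hp : IsPrimeAlgebra (LeavittPathAlgebra K G))
    {τ : Module.End K (LeavittPathAlgebra K G)}
    (hτ : τ ∈ algebraCentroid K (LeavittPathAlgebra K G))
    (h : ∀ (w : V) (k : K), τ (vertex K G w) ≠ k • vertex K G w) :
    G.IsRowFinite ∧ G.IsComet := by
  have hcomp : ∀ {v w : V} {μ : List E} {k : K}, G.IsPath v μ w →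
      ghostPath K G v μ * τ (vertex K G v) * path K G v μ ≠ k • vertex K G w := by
    intro v w μ k hμ h0
    obtain ⟨w, k, hk⟩ := exists_vertex_of_compress hτ hμ h0
    exact h w k hk
  have hap : ∀ v, ¬ ∀ N, ∃ μ w, G.IsPath v μ w ∧ IsAperiodic N μ := by
    intro v hv
    obtain ⟨N, hN⟩ := exists_compress_of_isAperiodic (τ (vertex K G v))
    obtain ⟨μ, w, hμ, hμN⟩ := hv N
    obtain ⟨k, hk⟩ := hN v w μ hμ hμN
    exact hcomp hμ hk
  have hrow : G.IsRowFinite := by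
    intro v
    by_contra hv
    obtain ⟨F, hF⟩ := exists_compress_edge (τ (vertex K G v))
    obtain ⟨e, rfl, heF⟩ := Set.Infinite.exists_notMem_finset hv F
    obtain ⟨k, hk⟩ := hF e heF
    exact hcomp (μ := [e]) ⟨rfl, rfl⟩ hk
  have hsink : ∀ v, (G.emitted v).Nonempty := by
    intro v
    by_contra hv
    obtain ⟨k, hk⟩ := exists_compress_sink hv (τ (vertex K G v))
    exact hcomp (μ := []) rfl hk
  have hexit : ∀ c, G.IsCycle c → G.HasNoExit c := by
    intro c hc e he f hfe
    by_contra hf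
    obtain ⟨c', hr, hc', hpath⟩ := hc.exists_rotated he
    exact hap _ fun N => hpath.exists_isAperiodic_of_exit hc'.1 (fun h' => hf (hr.mem_iff.2 h'))
      hfe N
  have hends : ∀ f : ℕ → E, G.IsInfinitePath f → ∃ c, G.IsCycle c ∧ EndsIn f c := by
    intro f hf
    refine hf.exists_endsIn hexit ?_
    by_contra hno
    refine hap _ (hf.exists_isAperiodic fun p q hpq => ?_)
    -- Without repeated vertices any two tails differ already in their first edge.
    refine ⟨0, fun h0 => hno ⟨q - p, p, by omega, ?_⟩⟩
    rw [show p + (q - p) = q by omega]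
    exact congrArg G.s h0.symm
  have hinf : ∀ v, ∃ f : ℕ → E, G.IsInfinitePath f ∧ G.s (f 0) = v := by
    intro v
    choose g hg using hsink
    let t : ℕ → V := fun n => Nat.rec v (fun _ w => G.r (g w)) n
    exact ⟨fun n => g (t n), fun i => (hg (t (i + 1))).symm, hg v⟩
  have := hp.1
  obtain ⟨v₀⟩ := nonempty_vertex (K := K) (G := G)
  obtain ⟨f₀, hf₀, -⟩ := hinf v₀
  obtain ⟨c, hc, -⟩ := hends f₀ hf₀
  have hrot : ∀ d, G.IsCycle d → c.IsRotated d := fun d hd =>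
    isRotated_of_isPrimeAlgebra hp hc hd (hexit c hc) (hexit d hd)
  have hend : ∀ f : ℕ → E, G.IsInfinitePath f → EndsIn f c := by
    intro f hf
    obtain ⟨d, hd, hfd⟩ := hends f hf
    exact hfd.of_isRotated (hrot d hd).symm hd.1
  refine ⟨hrow, c, hc, hrot, fun v => ?_, hend⟩
  obtain ⟨f, hf, rfl⟩ := hinf v
  obtain ⟨N, hN⟩ := hend f hf
  refine ⟨G.s (f (0 + N)), ⟨_, hf.isPath_segment 0 N⟩, f (0 + N),
    List.mem_iff_getElem?.2 ⟨_, (hN 0).trans ?_⟩, .inl rfl⟩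
  rw [zero_add, add_zero]

end LeavittPathAlgebra

/-! ### The cycle of a comet -/

namespace DirectedGraph

variable {V : Type u} {E : Type v} {G : DirectedGraph V E}

theorem IsCycle.exists_isPath {c : List E} (hc : G.IsCycle c) {e f : E} (he : e ∈ c) (hf : f ∈ c) :
    ∃ μ, G.IsPath (G.s f) μ (G.s e) := by
  obtain ⟨c', hr, -, hp⟩ := hc.exists_rotated he
  obtain ⟨a, b, hab⟩ := List.append_of_mem (hr.mem_iff.1 hf)
  rw [hab] at hp
  obtain ⟨w, -, h⟩ := hp.split
  exact ⟨f :: b, rfl, h.2⟩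

theorem IsCycle.exists_source_eq {c : List E} (hc : G.IsCycle c) {v : V} (hv : v ∈ G.vertexSet c) :
    ∃ e ∈ c, G.s e = v := by
  obtain ⟨e, he, rfl | rfl⟩ := hv
  · exact ⟨e, he, rfl⟩
  · exact hc.source_next_mem he

/-- An edge `f` leaving a vertex of `c` can be continued to a closed path, since every vertex
connects to `c`. Going round it forever is an infinite path that ends in `c` and contains `f` again
and again, so `f` lies on `c`. -/
theorem IsCycle.hasNoExit {c : List E} (hc : G.IsCycle c)
    (htree : ∀ v : V, (G.tree v ∩ G.vertexSet c).Nonempty)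
    (hend : ∀ f : ℕ → E, G.IsInfinitePath f → EndsIn f c) : G.HasNoExit c := by
  intro e he f hfe
  obtain ⟨x, ⟨ν, hν⟩, hx⟩ := htree (G.r f)
  obtain ⟨g, hg, rfl⟩ := hc.exists_source_eq hx
  obtain ⟨ρ, hρ⟩ := hc.exists_isPath he hg
  have hd : G.IsPath (G.s e) (f :: (ν ++ ρ)) (G.s e) := ⟨hfe, hν.append hρ⟩
  obtain ⟨N, hN⟩ := hend _ (hd.isInfinitePath_mod (by simp))
  -- A multiple of the period that is at least `N`: a position in the part running along `c` where
  -- the edge is `f`.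
  have hi : (N + ((f :: (ν ++ ρ)).length * N - N)) % (f :: (ν ++ ρ)).length = 0 := by
    rw [Nat.add_sub_cancel' (Nat.le_mul_of_pos_left N (by simp)), Nat.mul_mod_right]
  have h0 : ∀ (i : ℕ) (hi : i < (f :: (ν ++ ρ)).length), i = 0 → (f :: (ν ++ ρ))[i] = f := by
    rintro _ _ rfl; rfl
  exact List.mem_iff_getElem?.2 ⟨_, (hN _).trans (congrArg some (h0 _ _ hi))⟩

/-- The closed paths based at a vertex of a cycle without exits are the powers of the cycle. -/
theorem IsCycle.eq_listPow {c : List E} (hc : G.IsCycle c) {u : V} (hu : G.IsPath u c u)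
    {D : Set V} (hD : G.IsDeterministic D) (huD : u ∈ D) (n : ℕ) (α : List E) (hn : α.length ≤ n)
    (hα : G.IsPath u α u) : ∃ k, α = listPow c k := by
  induction n generalizing α with
  | zero => exact ⟨0, List.eq_nil_of_length_eq_zero (Nat.le_zero.1 hn)⟩
  | succ n ih =>
    rcases hD.prefix_or_prefix huD hu hα with ⟨x, rfl⟩ | ⟨x, rfl⟩
    · obtain ⟨w, h1, h2⟩ := hα.split
      obtain rfl := hu.range_unique h1
      have := List.length_pos_iff.2 hc.1
      obtain ⟨k, rfl⟩ := ih x (by rw [List.length_append] at hn; omega) h2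
      exact ⟨k + 1, (listPow_succ c k).symm⟩
    · by_cases h0 : α = []
      · exact ⟨0, h0⟩
      · obtain ⟨w, h1, h2⟩ := hu.split
        obtain rfl := hα.range_unique h1
        obtain rfl := hc.eq_nil_of_append h0 hα h2
        exact ⟨1, by simp [listPow]⟩

end DirectedGraph

/-! ### The centroid over a row-finite comet -/

namespace LeavittPathAlgebra

variable {V : Type u} {E : Type v} {K : Type w} [Field K] {G : DirectedGraph V E}

/-- At a vertex emitting a single edge `e`, (CK2) reads `e e* = s(e)`; the product collapses from
the inside. -/
theorem path_mul_ghostPath_of_isDeterministic (hrow : G.IsRowFinite) {D : Set V}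
    (hD : G.IsDeterministic D) {x y : V} (hx : x ∈ D) {η : List E} (h : G.IsPath x η y) :
    path K G x η * ghostPath K G x η = vertex K G x := by
  induction η generalizing x with
  | nil => exact vertex_mul_self K G x
  | cons e η ih =>
    obtain ⟨rfl, h⟩ := h
    have hem : (hrow (G.s e)).toFinset = {e} := by
      ext f
      rw [Set.Finite.mem_toFinset, Finset.mem_singleton]
      exact ⟨fun hf => (hD.eq_of_source_eq e f hx (Eq.symm hf)).symm, fun hf => hf ▸ rfl⟩
    rw [path, ghostPath, mul_assoc, ← mul_assoc (path K G (G.r e) η), ih (hD.range_mem e hx) h,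
      range_mul_ghost, vertex_eq_sum K G (G.s e) ⟨hrow _, ⟨e, rfl⟩⟩, hem, Finset.sum_singleton]

/-- A central element `z` of a corner `u L u` extends to the centroid, if each vertex times `z`
extends. -/
theorem exists_mem_centroid (hp : IsPrimeAlgebra (LeavittPathAlgebra K G)) {u : V}
    {z : LeavittPathAlgebra K G}
    (hz : ∀ s, z * s * vertex K G u = vertex K G u * s * z)
    (hv : ∀ v, ∃ b, ∀ s, b * s * vertex K G u = vertex K G v * s * z) :
    ∃ τ : algebraCentroid K (LeavittPathAlgebra K G), τ.1 (vertex K G u) = z := by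
  -- By primeness `b` is determined by the products `b s u`. Hence the `b` attached to `a` below is
  -- unique, and linearity and the centroid identities of `T` can be tested on such products.
  have huniq : ∀ {b b'}, (∀ s, b * s * vertex K G u = b' * s * vertex K G u) → b = b' := by
    intro b b' h
    refine sub_eq_zero.1 ((eq_zero_or_eq_zero_of_isPrimeAlgebra hp (b := vertex K G u)
      fun s => ?_).resolve_right (vertex_ne_zero u))
    rw [sub_mul, sub_mul, h, sub_self]
  have hex : ∀ a, ∃ b, ∀ s, b * s * vertex K G u = a * s * z := by
    intro a
    choose b hb using hv
    obtain ⟨F, hF⟩ := exists_finset_sum_mul a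
    refine ⟨∑ v ∈ F, b v * a, fun s => ?_⟩
    conv_rhs => rw [← hF F subset_rfl]
    simp only [Finset.sum_mul]
    refine Finset.sum_congr rfl fun v _ => ?_
    rw [mul_assoc (b v), hb, ← mul_assoc]
  choose T hT using hex
  have hadd : ∀ x y, T (x + y) = T x + T y := fun x y => huniq fun s => by
    rw [hT, add_mul, add_mul, add_mul, add_mul, hT, hT]
  have hsmul : ∀ (k : K) x, T (k • x) = k • T x := fun k x => huniq fun s => by
    rw [hT, smul_mul_assoc, smul_mul_assoc, smul_mul_assoc, smul_mul_assoc, hT]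
  refine ⟨⟨⟨⟨T, hadd⟩, hsmul⟩, fun x y => ⟨huniq fun s => ?_, huniq fun s => ?_⟩⟩,
    huniq fun s => ?_⟩
  · change T (x * y) * s * _ = T x * y * s * _
    rw [hT, mul_assoc (T x), hT, ← mul_assoc]
  · change T (x * y) * s * _ = x * T y * s * _
    rw [hT, mul_assoc x (T y), mul_assoc x (T y * s), hT, mul_assoc x y, mul_assoc x (y * s)]
  · change T _ * s * _ = _
    rw [hT, hz]

/-- If no `b` exists for a vertex, then by (CK2) none exists for the range of some edge it emits.
Iterating gives an infinite path of bad vertices. It ends in `c` and passes through `u`, yet `b = z`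
works at `u`. -/
theorem exists_mul_vertex_eq (hrow : G.IsRowFinite) {c : List E} (hc : G.IsCycle c) {u : V}
    (hu : G.IsPath u c u) (htree : ∀ v : V, (G.tree v ∩ G.vertexSet c).Nonempty)
    (hend : ∀ f : ℕ → E, G.IsInfinitePath f → EndsIn f c) {z : LeavittPathAlgebra K G}
    (hz : ∀ s, z * s * vertex K G u = vertex K G u * s * z) (v : V) :
    ∃ b, ∀ s, b * s * vertex K G u = vertex K G v * s * z := by
  by_contra hv
  have hem : ∀ v, (G.emitted v).Nonempty := by
    intro v
    obtain ⟨x, ⟨μ, hμ⟩, hx⟩ := htree v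
    cases μ with
    | nil =>
      obtain rfl : v = x := hμ
      obtain ⟨e, -, he⟩ := hc.exists_source_eq hx
      exact ⟨e, he⟩
    | cons e μ => exact ⟨e, hμ.1⟩
  have hstep : ∀ t ∈ {v | ¬ ∃ b, ∀ s, b * s * vertex K G u = vertex K G v * s * z},
      ∃ e, G.s e = t ∧ G.r e ∈ {v | ¬ ∃ b, ∀ s, b * s * vertex K G u = vertex K G v * s * z} := by
    intro t ht
    by_contra hno
    have hr : ∀ e, ∃ b, G.s e = t → ∀ s, b * s * vertex K G u = vertex K G (G.r e) * s * z := by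
      intro e
      by_cases he : G.s e = t
      · obtain ⟨b, hb⟩ := not_not.1 fun h => hno ⟨e, he, h⟩
        exact ⟨b, fun _ => hb⟩
      · exact ⟨0, fun h => absurd h he⟩
    choose b hb using hr
    -- Solutions `b e` at the ranges are transported back to `t` by conjugation with the edges,
    -- matching `t = ∑ e e*`.
    refine ht ⟨∑ e ∈ (hrow t).toFinset, edge K G e * b e * ghost K G e, fun s => ?_⟩
    rw [vertex_eq_sum K G t ⟨hrow t, hem t⟩]
    simp only [Finset.sum_mul]
    refine Finset.sum_congr rfl fun e he => ?_
    have := hb e (by simpa [emitted] using he) (ghost K G e * s)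
    rw [← mul_assoc, ← mul_assoc (vertex K G _), range_mul_ghost] at this
    calc edge K G e * b e * ghost K G e * s * vertex K G u
        = edge K G e * (b e * ghost K G e * s * vertex K G u) := by simp only [mul_assoc]
      _ = edge K G e * ghost K G e * s * z := by rw [this]; simp only [mul_assoc]
  obtain ⟨f, hf, hfB⟩ := exists_infinitePath hstep hv
  obtain ⟨N, hN⟩ := hend f hf
  have h0 := hN 0
  have hlen := List.length_pos_iff.2 hc.1
  rw [Nat.zero_mod, List.getElem?_eq_getElem hlen] at h0
  have hs := hu.source_getElem_zero hlen
  rw [Option.some_injective _ h0] at hs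
  exact hfB (N + 0) ⟨z, hs.symm ▸ hz⟩

/-- The corner at a vertex of a cycle without exits is spanned by the products of powers of the
cycle and its ghost. -/
theorem corner_induction (hrow : G.IsRowFinite) {c : List E} (hc : G.IsCycle c) {u : V}
    (hu : G.IsPath u c u) (hx : G.HasNoExit c) {p : LeavittPathAlgebra K G → Prop}
    (zero : p 0) (add : ∀ a b, p a → p b → p (a + b)) (smul : ∀ (k : K) a, p a → p (k • a))
    (monomial : ∀ j k, p (path K G u (listPow c j) * ghostPath K G u (listPow c k)))
    (a : LeavittPathAlgebra K G) : p (vertex K G u * a * vertex K G u) := by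
  have hD := hc.isDeterministic hx
  obtain ⟨e, he, rfl⟩ : ∃ e ∈ c, G.s e = u := by
    cases c with
    | nil => exact absurd rfl hc.1
    | cons e c => exact ⟨e, by simp, hu.1⟩
  induction a using induction_on with
  | zero => rw [mul_zero, zero_mul]; exact zero
  | add a b ha hb => rw [mul_add, add_mul]; exact add _ _ ha hb
  | smul k a ha => rw [mul_smul_comm, smul_mul_assoc]; exact smul _ _ ha
  | monomial u₁ u₂ x α β hα hβ =>
    by_cases h₁ : G.s e = u₁
    · by_cases h₂ : G.s e = u₂
      · subst h₁ h₂
        have hxD := hD.mem_of_isPath ⟨e, he, rfl⟩ hα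
        obtain ⟨f, hf, rfl⟩ := hxD
        -- The path `η` closes `α` and `β` up to powers of `c`; inserting `η η*`, which is a vertex,
        -- does not change `α β*`.
        obtain ⟨η, hη⟩ := hc.exists_isPath he hf
        obtain ⟨j, hj⟩ := hc.eq_listPow hu hD ⟨e, he, rfl⟩ _ _ le_rfl (hα.append hη)
        obtain ⟨k, hk⟩ := hc.eq_listPow hu hD ⟨e, he, rfl⟩ _ _ le_rfl (hβ.append hη)
        have := monomial j k
        rw [← hj, ← hk, path_append K η hα hη, ghostPath_append K η hβ hη, mul_assoc,
          ← mul_assoc (path K G (G.s f) η), path_mul_ghostPath_of_isDeterministic hrow hD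
          ⟨f, hf, rfl⟩ hη, range_mul_ghostPath K hβ] at this
        rwa [← mul_assoc, source_mul_path K hα, mul_assoc, ghostPath_mul_source K hβ]
      · rw [mul_assoc, mul_assoc, ghostPath_mul_vertex_of_ne K hβ h₂, mul_zero, mul_zero]
        exact zero
    · rw [← mul_assoc, vertex_mul_path_of_ne K hα h₁, zero_mul, zero_mul]
      exact zero

theorem nonempty_centroid_equiv_laurentPolynomial (hp : IsPrimeAlgebra (LeavittPathAlgebra K G))
    (hrow : G.IsRowFinite) (hcomet : G.IsComet) :
    Nonempty (algebraCentroid K (LeavittPathAlgebra K G) ≃ₐ[K] LaurentPolynomial K) := by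
  obtain ⟨c, hc, -, htree, hend⟩ := hcomet
  have hx := hc.hasNoExit htree hend
  obtain ⟨u, hu⟩ := hc.2.1
  have huD : u ∈ {v | ∃ e ∈ c, G.s e = v} := by
    cases c with
    | nil => exact absurd rfl hc.1
    | cons e c => exact ⟨e, by simp, hu.1⟩
  set U := vertex K G u
  set C := path K G u c
  set C' := ghostPath K G u c
  have hCC' : C * C' = U :=
    path_mul_ghostPath_of_isDeterministic hrow (hc.isDeterministic hx) huD hu
  have hC'C : C' * C = U := ghostPath_mul_path K hu
  have hUC : U * C = C := source_mul_path K hu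
  have hCU : C * U = C := path_mul_range K hu
  have hUC' : U * C' = C' := range_mul_ghostPath K hu
  have hC'U : C' * U = C' := ghostPath_mul_source K hu
  have hP : ∀ j, path K G u (listPow c (j + 1)) = C * path K G u (listPow c j) := fun j => by
    rw [listPow_succ, path_append K _ hu (isPath_listPow hu j)]
  have hG : ∀ j, ghostPath K G u (listPow c (j + 1)) = ghostPath K G u (listPow c j) * C' :=
    fun j => by rw [listPow_succ, ghostPath_append K _ hu (isPath_listPow hu j)]
  have hCP : ∀ j, C * path K G u (listPow c j) = path K G u (listPow c j) * C := by
    intro j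
    induction j with
    | zero => exact hCU.trans hUC.symm
    | succ j ih => rw [hP, mul_assoc C, ← ih]
  have hC'G : ∀ j, C' * ghostPath K G u (listPow c j) = ghostPath K G u (listPow c j) * C' := by
    intro j
    induction j with
    | zero => exact hC'U.trans hUC'.symm
    | succ j ih => rw [hG, ← mul_assoc, ih]
  have hCG : ∀ j, C * ghostPath K G u (listPow c j) = ghostPath K G u (listPow c j) * C := by
    intro j
    cases j with
    | zero => exact hCU.trans hUC.symm
    | succ j =>
      rw [hG, mul_assoc, hC'C, ← hC'G, ← mul_assoc, hCC',
        range_mul_ghostPath K (isPath_listPow hu j), ghostPath_mul_source K (isPath_listPow hu j)]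
  have hcomm : ∀ s, C * (U * s * U) = (U * s * U) * C := by
    refine corner_induction (p := fun a => C * a = a * C) hrow hc hu hx ?_ ?_ ?_ ?_
    · rw [mul_zero, zero_mul]
    · intro a b ha hb; rw [mul_add, add_mul, ha, hb]
    · intro k a ha; rw [mul_smul_comm, smul_mul_assoc, ha]
    · intro j k; rw [← mul_assoc, hCP, mul_assoc, hCG, mul_assoc]
  have hz : ∀ s, C * s * U = U * s * C := by
    intro s
    have := hcomm s
    rwa [← mul_assoc, ← mul_assoc, hCU, mul_assoc (U * s), hUC] at this
  -- Centrality passes from `c` to its inverse `c*` in the corner.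
  have hz' : ∀ s, C' * s * U = U * s * C' := by
    intro s
    calc C' * s * U = C' * s * (C * C') := by rw [hCC']
      _ = C' * (U * s * C) * C' := by
        rw [← mul_assoc C', ← mul_assoc C', hC'U]; simp only [mul_assoc]
      _ = U * s * C' := by
        rw [← hz, ← mul_assoc, ← mul_assoc, hC'C, mul_assoc (U * s), hUC']
  obtain ⟨τ, hτ⟩ := exists_mem_centroid hp hz (exists_mul_vertex_eq hrow hc hu htree hend hz)
  obtain ⟨τ', hτ'⟩ := exists_mem_centroid hp hz' (exists_mul_vertex_eq hrow hc hu htree hend hz')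
  change τ.1 U = C at hτ
  change τ'.1 U = C' at hτ'
  let t : (algebraCentroid K (LeavittPathAlgebra K G))ˣ :=
    { val := τ
      inv := τ'
      val_inv := centroid_ext hp u (by
        change τ.1 (τ'.1 U) = U
        rw [hτ', ← hUC', (τ.2 _ _).1, hτ, hCC'])
      inv_val := centroid_ext hp u (by
        change τ'.1 (τ.1 U) = U
        rw [hτ, ← hUC, (τ'.2 _ _).1, hτ', hC'C]) }
  have hpow : ∀ j : ℕ, (τ ^ j).1 U = path K G u (listPow c j) := by
    intro j
    induction j with
    | zero => rfl
    | succ j ih =>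
      rw [pow_succ']
      change τ.1 ((τ ^ j).1 U) = _
      rw [ih, ← source_mul_path K (isPath_listPow hu j), (τ.2 _ _).1, hτ, hP]
  have hpow' : ∀ j : ℕ, (τ' ^ j).1 U = ghostPath K G u (listPow c j) := by
    intro j
    induction j with
    | zero => rfl
    | succ j ih =>
      rw [pow_succ']
      change τ'.1 ((τ' ^ j).1 U) = _
      rw [ih, ← ghostPath_mul_source K (isPath_listPow hu j), (τ'.2 _ _).2, hτ', hG]
  let Φ : LaurentPolynomial K →ₐ[K] algebraCentroid K (LeavittPathAlgebra K G) :=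
    AddMonoidAlgebra.lift K _ ℤ ((Units.coeHom _).comp (zpowersHom _ t))
  have hΦT : ∀ n : ℤ, Φ (LaurentPolynomial.T n) = ((t ^ n : Units _) : _) := by
    intro n
    refine (AddMonoidAlgebra.lift_single _ _ _).trans ?_
    rw [one_smul]; rfl
  refine ⟨(AlgEquiv.ofBijective Φ ⟨?_, ?_⟩).symm⟩
  · refine (injective_iff_map_eq_zero Φ).2 fun f hf => ?_
    -- Multiplying by a power of the unit `T` leaves a polynomial `g`, and evaluation of `g(τ) = 0`
    -- at `u` is a relation between the powers of `c`.
    obtain ⟨n, g, hg⟩ := f.exists_T_pow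
    have hcomp : Φ.comp Polynomial.toLaurentAlg = Polynomial.aeval τ := by
      refine Polynomial.algHom_ext ?_
      rw [AlgHom.comp_apply, Polynomial.toLaurentAlg_apply, Polynomial.toLaurent_X, hΦT,
        Polynomial.aeval_X, zpow_one]
    have h0 : Polynomial.aeval τ g = 0 := by
      rw [← hcomp, AlgHom.comp_apply, Polynomial.toLaurentAlg_apply, hg, map_mul, hf, zero_mul]
    rw [Polynomial.aeval_eq_sum_range] at h0
    have h1 : ∑ i ∈ Finset.range (g.natDegree + 1),
        g.coeff i • path K G u (listPow c i) = 0 := by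
      have := congrArg (fun σ : algebraCentroid K (LeavittPathAlgebra K G) => σ.1 U) h0
      simp only [AddSubmonoidClass.coe_finsetSum, LinearMap.sum_apply] at this
      refine Eq.trans (Finset.sum_congr rfl fun i _ => ?_) this
      rw [← hpow]; rfl
    have hli := linearIndependent_path (K := K) (listPow c) (isPath_listPow hu) fun i j hij => by
      simp only [length_listPow] at hij
      exact Nat.eq_of_mul_eq_mul_right (List.length_pos_iff.2 hc.1) hij
    have h2 := linearIndependent_iff'.1 hli _ _ h1
    have hg0 : g = 0 := by
      ext i
      by_cases hi : i < g.natDegree + 1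
      · exact h2 i (Finset.mem_range.2 hi)
      · exact Polynomial.coeff_eq_zero_of_natDegree_lt (by omega)
    rw [hg0, map_zero] at hg
    exact (LaurentPolynomial.isUnit_T (n : ℤ)).mul_left_eq_zero.1 hg.symm
  · intro σ
    -- The values at `u` of the image of `Φ` exhaust the corner, and `σ(u) = u σ(u) u` lies in it;
    -- agreement at `u` is enough.
    have key : ∀ a, ∃ q, (Φ q).1 U = U * a * U := by
      refine corner_induction (p := fun a => ∃ q, (Φ q).1 U = a) hrow hc hu hx ?_ ?_ ?_ ?_
      · exact ⟨0, by rw [map_zero]; rfl⟩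
      · rintro a b ⟨q, rfl⟩ ⟨q', rfl⟩
        exact ⟨q + q', by rw [map_add]; rfl⟩
      · rintro k a ⟨q, rfl⟩
        exact ⟨k • q, by rw [map_smul]; rfl⟩
      · intro j k
        refine ⟨LaurentPolynomial.T j * LaurentPolynomial.T (-k), ?_⟩
        rw [map_mul, hΦT, hΦT, zpow_neg, zpow_natCast, zpow_natCast, ← inv_pow,
          Units.val_pow_eq_pow_val, Units.val_pow_eq_pow_val]
        change (τ ^ j).1 ((τ' ^ k).1 U) = _
        rw [hpow', ← range_mul_ghostPath K (isPath_listPow hu k), ((τ ^ j).2 _ _).1, hpow,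
          range_mul_ghostPath K (isPath_listPow hu k)]
    obtain ⟨q, hq⟩ := key (σ.1 U)
    refine ⟨q, centroid_ext hp u (hq.trans ?_)⟩
    rw [← (σ.2 _ _).2, ← (σ.2 _ _).1, vertex_mul_self, vertex_mul_self]

end LeavittPathAlgebra

theorem mainTheorem1 {K : Type w} [Field K] {V : Type u} {E : Type v} (G : DirectedGraph V E)
    (hprime : IsPrimeAlgebra (LeavittPathAlgebra K G)) :
    (G.IsRowFinite ∧ G.IsComet →
      Nonempty (algebraCentroid K (LeavittPathAlgebra K G) ≃ₐ[K] LaurentPolynomial K)) ∧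
    (¬ (G.IsRowFinite ∧ G.IsComet) →
      Nonempty (algebraCentroid K (LeavittPathAlgebra K G) ≃ₐ[K] K)) := by
  refine ⟨fun h => LeavittPathAlgebra.nonempty_centroid_equiv_laurentPolynomial hprime h.1 h.2,
    fun h => LeavittPathAlgebra.nonempty_centroid_equiv hprime fun τ hτ => ?_⟩
  by_contra hno
  push Not at hno
  exact h (LeavittPathAlgebra.isComet_of_centroid hprime hτ hno)
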